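/- Let $p_0\ge 1$ be a rational number with continued fraction $p_0=[\nu_0,\nu_1,\dots,\nu_\alpha]$ (all $\nu_i\ge 1$, and $\nu_\alpha\ge 2$ if $\alpha>0$). Define $y_{-1}=0$, $y_0=1$, $y_{i+1}=y_{i-1}+\nu_iy_i$ $(0\le i\le\alpha)$; $z_{-1}=0$, $z_0=1$, $z_{i+1}=z_{i-1}+\nu_{i+1}z_i$ $(0\le i<\alpha)$; $m_i=\nu_0+\dots+\nu_{i-1}$ $(0\le i\le\alpha+1)$. For $0\le j\le m_{\alpha+1}$ let $r(j)=i$ if $m_i\le j<m_{i+1}$ with $i\le\alpha$, and $r(m_{\alpha+1})=\alpha+1$. Put $n_j=y_{i-1}+(j-m_i)y_i$ for $i=r(j)$, and $\epsilon_j=(-1)^{r(j)}$. Let $\Theta^{-1}=(c_{ij})_{1\le i,j\le m_{\alpha+1}}$ be the (invertible) symmetric tridiagonal matrix with $c_{j-1,j}=c_{j,j-1}=(-1)^{r(j)-1}$ for $2\le j\le m_{\alpha+1}$ and with diagonal entries $$c_{jj}=\begin{cases}2(-1)^i,& m_i\le j<m_{i+1}-1,\ i\le\alpha,\\ (-1)^i,&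 j=m_{i+1}-1,\ i\le\alpha,\\ (-1)^{\alpha+1},& j=m_{\alpha+1},\end{cases}$$ and let $B=2\Theta$. Write $(a;q)_N=\prod_{i=0}^{N-1}(1-aq^i)$, and $\left[{M\atop N}\right]_q=\frac{(q;q)_M}{(q;q)_N(q;q)_{M-N}}$ if $0\le N\le M$ and $\left[{M\atop N}\right]_q=0$ otherwise. For $l\ge 0$ let $$V_l(q)=\sum_{\lambda}\frac{q^{\frac12\widetilde\lambda B\widetilde\lambda^t}}{\prod_{j}(q^{\epsilon_j};q^{\epsilon_j})_{\lambda_j}},$$ where $\lambda=(\lambda_1,\dots,\lambda_{m_{\alpha+1}})$ runs over the sequences of non-negative integers with $\sum_k n_k\lambda_k=l$, and $\widetilde\lambda_j=\epsilon_j\lambda_j$. For $k\ge m\ge 0$ with $(k,m)\ne(0,0)$ let $$Q^{(\pm)}_{k,m}(q)=q^{\frac{1\mp1}{2}(k+m)}\left[{k-1\atop m}\right]_q+q^{\frac{1\pm1}{2}(2k-m)}\left[{k-1\atop m-1}\right]_q,$$ $$\Delta_\alpha(k,m)=\frac{1+(-1)^\alpha}{2}\binom{k-m}{2}+\frac{1-(-1)^\alpha}{2}\binom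 m2 ,$$ and let $Q_{k,m}^{((-1)^\alpha)}$ be $Q^{(+)}_{k,m}$ if $\alpha$ is even and $Q^{(-)}_{k,m}$ if $\alpha$ is odd. Theorem. For every rational $p_0\ge1$, $$\sum_{l\ge0}q^{l^2/p_0}V_l(q)=1+\sum_{\substack{k\ge m\ge0\\(k,m)\ne(0,0)}}(-1)^{\frac{1+(-1)^\alpha}{2}k+m}\,q^{(ky_{\alpha+1}+my_\alpha)(kz_\alpha+mz_{\alpha-1})+\Delta_\alpha(k,m)}\,\frac{Q^{((-1)^\alpha)}_{k,m}(q)}{(q;q)_k}.$$ The identity holds both formally and analytically. Formally: in the field of Hahn series in $q$ over $\mathbb Q$ with exponents in $\mathbb Q$, where every summand is expanded in increasing powers of $q$, the families of summands on both sides (indexed by $l$, respectively by $(k,m)$) are summable and their sums agree. Analytically: for every $\tau$ in the upper half-plane, with $q^a=e^{2\pi i a\tau}$ for $a\in\mathbb Q$, both series converge absolutely and the identity holds. -/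

import Mathlib

namespace XXZ

/-- The remainders of the Euclidean algorithm started at `p₀, 1`:
`p_{i+2} = p_i - ⌊p_i / p_{i+1}⌋ p_{i+1}`. -/
def p (p₀ : ℚ) : ℕ → ℚ
  | 0 => p₀
  | 1 => 1
  | i + 2 => p p₀ i - (⌊p p₀ i / p p₀ (i + 1)⌋₊ : ℚ) * p p₀ (i + 1)

/-- The partial quotients `ν_i = ⌊p_i / p_{i+1}⌋` of `p₀ = [ν_0, ν_1, …]`. -/
def nu (p₀ : ℚ) (i : ℕ) : ℕ := ⌊p p₀ i / p p₀ (i + 1)⌋₊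

/-- The index `α` of the last partial quotient, `p₀ = [ν_0, …, ν_α]`: the first `i` for which the
division of `p_i` by `p_{i+1}` leaves no remainder
(it exists for rational `p₀ ≥ 1`, see `exists_p_eq_zero`). -/
noncomputable def alpha (p₀ : ℚ) : ℕ := sInf {i | p p₀ (i + 2) = 0}

/-- `yPrev p₀ i = y_{i-1}`: `y_{-1} = 0`, `y_0 = 1`, `y_{i+1} = y_{i-1} + ν_i y_i`. -/
def yPrev (p₀ : ℚ) : ℕ → ℕ
  | 0 => 0
  | 1 => 1
  | i + 2 => yPrev p₀ i + nu p₀ i * yPrev p₀ (i + 1)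

/-- `y_i` for `i ≥ 0`. -/
def y (p₀ : ℚ) (i : ℕ) : ℕ := yPrev p₀ (i + 1)

/-- `zPrev p₀ i = z_{i-1}`: `z_{-1} = 0`, `z_0 = 1`, `z_{i+1} = z_{i-1} + ν_{i+1} z_i`. -/
def zPrev (p₀ : ℚ) : ℕ → ℕ
  | 0 => 0
  | 1 => 1
  | i + 2 => zPrev p₀ i + nu p₀ (i + 1) * zPrev p₀ (i + 1)

/-- `z_i` for `i ≥ 0`. -/
def z (p₀ : ℚ) (i : ℕ) : ℕ := zPrev p₀ (i + 1)

/-- `m_i = ν_0 + ⋯ + ν_{i-1}`. -/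
def m (p₀ : ℚ) (i : ℕ) : ℕ := ∑ t ∈ Finset.range i, nu p₀ t

/-- The number `m_{α+1}` of components of the vectors `λ`. -/
noncomputable def size (p₀ : ℚ) : ℕ := m p₀ (alpha p₀ + 1)

/-- `r(j) = i` if `m_i ≤ j < m_{i+1}`, where the last interval, `i = α + 1`, is
`m_{α+1} ≤ j`. (The `m_i`, `i ≤ α + 1`, are strictly increasing from `m_0 = 0`.) -/
noncomputable def r (p₀ : ℚ) (j : ℕ) : ℕ :=
  Nat.findGreatest (fun i => m p₀ i ≤ j) (alpha p₀ + 1)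

/-- `n_j = y_{i-1} + (j - m_i) y_i` for `i = r(j)`. -/
noncomputable def n (p₀ : ℚ) (j : ℕ) : ℕ :=
  yPrev p₀ (r p₀ j) + (j - m p₀ (r p₀ j)) * y p₀ (r p₀ j)

/-- The sign `ε_j = (-1)^{r(j)}`. -/
noncomputable def eps (p₀ : ℚ) (j : ℕ) : ℚ := (-1) ^ r p₀ j

/-- The entries `c_{jk}`, `1 ≤ j, k ≤ m_{α+1}`, of the symmetric tridiagonal matrix `Θ⁻¹`.
The off-diagonal sign `(-1)^{i-1}` is written `(-1)^{i+1}`. -/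
noncomputable def c (p₀ : ℚ) (j k : ℕ) : ℚ :=
  if j = k then
    if j = size p₀ then (-1) ^ (alpha p₀ + 1)
    else if j + 1 = m p₀ (r p₀ j + 1) then (-1) ^ r p₀ j
    else 2 * (-1) ^ r p₀ j
  else if k = j + 1 then (-1) ^ (r p₀ k + 1)
  else if j = k + 1 then (-1) ^ (r p₀ j + 1)
  else 0

/-- The matrix `Θ⁻¹`; the index `j : Fin m_{α+1}` stands for the label `j + 1`. -/
noncomputable def thetaInv (p₀ : ℚ) : Matrix (Fin (size p₀)) (Fin (size p₀)) ℚ :=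
  Matrix.of fun j k => c p₀ ((j : ℕ) + 1) ((k : ℕ) + 1)

/-- The matrix `B = 2 Θ`. (`Θ⁻¹` is invertible, with determinant `± y_{α+1}`.) -/
noncomputable def B (p₀ : ℚ) : Matrix (Fin (size p₀)) (Fin (size p₀)) ℚ :=
  (2 : ℚ) • (thetaInv p₀)⁻¹

/-- `λ̃_j = (-1)^{r(j)} λ_j`. -/
noncomputable def twist (p₀ : ℚ) (lam : Fin (size p₀) → ℕ) : Fin (size p₀) → ℚ :=
  fun j => eps p₀ ((j : ℕ) + 1) * lam j

/-- The exponent `½ λ̃ B λ̃ᵗ`. -/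
noncomputable def halfForm (p₀ : ℚ) (lam : Fin (size p₀) → ℕ) : ℚ :=
  1 / 2 * (twist p₀ lam ⬝ᵥ (B p₀).mulVec (twist p₀ lam))

/-- The sequences `λ` of non-negative integers with `∑ n_k λ_k = l`. The bound `λ_k ≤ l` only
serves to have a finite set at hand, see `mem_confs`. -/
noncomputable def confs (p₀ : ℚ) (l : ℕ) : Finset (Fin (size p₀) → ℕ) :=
  (Fintype.piFinset fun _ => Finset.range (l + 1)).filter
    fun lam => ∑ k : Fin (size p₀), n p₀ ((k : ℕ) + 1) * lam k = l

section Field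

variable {K : Type*} [Field K]

/-- `(a; x)_N = ∏_{i < N} (1 - a x^i)`. -/
def poch (a x : K) (N : ℕ) : K := ∏ i ∈ Finset.range N, (1 - a * x ^ i)

/-- The Gaussian binomial coefficient `[M choose N]_x`, zero unless `0 ≤ N ≤ M`. -/
def gauss (x : K) (M N : ℤ) : K :=
  if 0 ≤ N ∧ N ≤ M then
    poch x x M.toNat / (poch x x N.toNat * poch x x (M - N).toNat)
  else 0

/-! In the following definitions `pw : ℚ → K` is the function `a ↦ q^a`, so that `q = pw 1`. -/

/-- The fermionic sum `V_l(q)`. -/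
noncomputable def V (p₀ : ℚ) (pw : ℚ → K) (l : ℕ) : K :=
  ∑ lam ∈ confs p₀ l, pw (halfForm p₀ lam) /
    ∏ j : Fin (size p₀), poch (pw (eps p₀ ((j : ℕ) + 1))) (pw (eps p₀ ((j : ℕ) + 1))) (lam j)

/-- The summand `q^{l²/p₀} V_l(q)` of the left-hand side. -/
noncomputable def lhsTerm (p₀ : ℚ) (pw : ℚ → K) (l : ℕ) : K :=
  pw ((l : ℚ) ^ 2 / p₀) * V p₀ pw l

/-- `Q^{(σ)}_{k,m}(q)` for a sign `σ = ± 1`. -/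
def Q (σ : ℚ) (pw : ℚ → K) (k m : ℕ) : K :=
  pw ((1 - σ) / 2 * (k + m)) * gauss (pw 1) ((k : ℤ) - 1) (m : ℤ) +
    pw ((1 + σ) / 2 * (2 * k - m)) * gauss (pw 1) ((k : ℤ) - 1) ((m : ℤ) - 1)

/-- `Δ_α(k, m)` for `k ≥ m`. -/
def Delta (α k m : ℕ) : ℚ :=
  (1 + (-1) ^ α) / 2 * ((k - m).choose 2 : ℚ) + (1 - (-1) ^ α) / 2 * (m.choose 2 : ℚ)

/-- The summand of the bosonic double sum. -/
noncomputable def rhsTerm (p₀ : ℚ) (pw : ℚ → K) (k m : ℕ) : K :=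
  (-1) ^ ((1 + (-1) ^ alpha p₀) / 2 * (k : ℤ) + m) *
    pw (((k : ℚ) * y p₀ (alpha p₀ + 1) + m * y p₀ (alpha p₀)) *
        (k * z p₀ (alpha p₀) + m * zPrev p₀ (alpha p₀)) + Delta (alpha p₀) k m) *
    (Q ((-1) ^ alpha p₀) pw k m / poch (pw 1) (pw 1) k)

end Field

/-- The index set of the bosonic sum: pairs `(k, m) ≠ (0, 0)` with `k ≥ m ≥ 0`. -/
abbrev Pairs : Type := {x : ℕ × ℕ // x.2 ≤ x.1 ∧ x ≠ (0, 0)}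

/-- `a ↦ q^a` for a formal variable `q`, in the field of Hahn series with rational exponents. -/
noncomputable def formalPow (a : ℚ) : HahnSeries ℚ ℚ := HahnSeries.single a 1

/-- `a ↦ q^a = exp(2πi a τ)` for `q = exp(2πi τ)`. -/
noncomputable def complexPow (τ : UpperHalfPlane) (a : ℚ) : ℂ :=
  Complex.exp (2 * Real.pi * Complex.I * a * τ)

/-! Well-definedness of `alpha` and `confs`. -/

theorem p_nonneg {p₀ : ℚ} (h : 1 ≤ p₀) (i : ℕ) : 0 ≤ p p₀ i := by
  induction i using Nat.twoStepInduction with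
  | zero => simp only [p]; linarith
  | one => simp [p]
  | more i h1 h2 =>
    rcases h2.eq_or_lt with h0 | h0
    · simp only [p, ← h0]; simpa using h1
    · have := Nat.floor_le (div_nonneg h1 h2)
      rw [le_div_iff₀ h0] at this
      simp only [p]; linarith

theorem p_int (p₀ : ℚ) (i : ℕ) : ∃ a : ℤ, p p₀ i * p₀.den = a := by
  induction i using Nat.twoStepInduction with
  | zero => exact ⟨p₀.num, by simp only [p]; exact Rat.mul_den_eq_num p₀⟩
  | one => exact ⟨p₀.den, by simp [p]⟩
  | more i h1 h2 =>
    obtain ⟨a, ha⟩ := h1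
    obtain ⟨b, hb⟩ := h2
    refine ⟨a - ⌊p p₀ i / p p₀ (i + 1)⌋₊ * b, ?_⟩
    simp only [p]; push_cast; rw [← ha, ← hb]; ring

theorem exists_p_eq_zero {p₀ : ℚ} (h : 1 ≤ p₀) : {i | p p₀ (i + 2) = 0}.Nonempty := by
  by_contra hne
  rw [Set.not_nonempty_iff_eq_empty, Set.eq_empty_iff_forall_notMem] at hne
  have hpos : ∀ i, 0 < p p₀ (i + 1) := fun i => by
    rcases i with _ | i
    · simp [p]
    · exact lt_of_le_of_ne (p_nonneg h _) (Ne.symm (hne i))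
  have hd : (0 : ℚ) < p₀.den := by exact_mod_cast p₀.den_pos
  choose a ha using p_int p₀
  have hlt : ∀ i, p p₀ (i + 2) < p p₀ (i + 1) := fun i => by
    have := Nat.lt_floor_add_one (p p₀ i / p p₀ (i + 1))
    rw [div_lt_iff₀ (hpos i)] at this
    simp only [p]; linarith
  refine not_strictAnti_of_wellFoundedLT (fun i => (a (i + 1)).toNat) ?_
  refine strictAnti_nat_of_succ_lt fun i => ?_
  have h1 : (a (i + 2) : ℚ) < a (i + 1) := by
    rw [← ha, ← ha]; exact mul_lt_mul_of_pos_right (hlt i) hd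
  have h2 : (0 : ℚ) < a (i + 1) := by
    rw [← ha]; exact mul_pos (hpos i) hd
  have h1' : a (i + 2) < a (i + 1) := by exact_mod_cast h1
  have h2' : 0 < a (i + 1) := by exact_mod_cast h2
  change (a (i + 2)).toNat < (a (i + 1)).toNat
  omega

theorem y_pos {p₀ : ℚ} (h : 1 ≤ p₀) (i : ℕ) : 0 < y p₀ i := by
  have h0 : 0 < nu p₀ 0 := by
    simp only [nu, p, div_one]; exact Nat.floor_pos.mpr h
  induction i using Nat.twoStepInduction with
  | zero => simp [y, yPrev]
  | one => simpa [y, yPrev] using h0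
  | more i h1 _ =>
    have : y p₀ (i + 2) = y p₀ i + nu p₀ (i + 1) * y p₀ (i + 1) := rfl
    omega

theorem n_pos {p₀ : ℚ} (h : 1 ≤ p₀) {j : ℕ} (hj : 0 < j) : 0 < n p₀ j := by
  unfold n
  rcases r p₀ j with _ | i
  · simpa [m, y, yPrev] using hj
  · exact Nat.add_pos_left (y_pos h i) _

theorem mem_confs {p₀ : ℚ} (h : 1 ≤ p₀) (l : ℕ) (lam : Fin (size p₀) → ℕ) :
    lam ∈ confs p₀ l ↔ ∑ k : Fin (size p₀), n p₀ ((k : ℕ) + 1) * lam k = l := by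
  simp only [confs, Finset.mem_filter, Fintype.mem_piFinset, Finset.mem_range,
    and_iff_right_iff_imp]
  rintro rfl k
  have h1 : lam k ≤ n p₀ ((k : ℕ) + 1) * lam k :=
    Nat.le_mul_of_pos_left _ (n_pos h (Nat.succ_pos (k : ℕ)))
  have h2 := Finset.single_le_sum (f := fun k : Fin (size p₀) => n p₀ ((k : ℕ) + 1) * lam k)
    (fun _ _ => Nat.zero_le _) (Finset.mem_univ k)
  exact Nat.lt_succ_of_le (h1.trans h2)

end XXZ

/-! The numbers n_j are first coordinates of lattice points e_j = (n_j, s_j) (`sail`), which lie on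
the broken lines joining the convergents (y_{i-1}, z_{i-2}) of p₀. The matrix Θ is a Green matrix:
its (j, k) entry is u_{min} v_{max} with u_j = ε_j n_j and v_j = ε_j (s_j - n_j / p₀). Adding l² /
p₀ cancels the 1 / p₀ part, and the whole exponent becomes the integral form ∑ n_{min(i,j)}
s_{max(i,j)} λ_i λ_j (`sq_div_add_halfForm`). In this form the last component of λ sees the others
only through u = ∑ n_k λ_k, so the components can be summed one at a time.

The invariant of this process is that the sum over the first J components at level u equals a sum
over the points a F + b G with first coordinate u of a unimodular cone, with weight `coeffW Q a b`,
Q = q^{±1}, and q raised to the product of the two coordinates. It starts from δ_{u,0}, which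
belongs to the cone of (1,1) and (1,0) (`latticeSum_base`). Inside a stage of the continued fraction
the next e_j is F, and the q-binomial theorem narrows (F, G) to (F + G, G) (`latticeSum_step`). At a
corner the next e_j is G, and the symmetry of `coeffW` under Q ↦ Q⁻¹ first exchanges F and G
(`latticeSum_turn`).

After the last component, the points of the remaining cone, with k = a + b and m = a, carry exactly
the bosonic summands (`rhsTerm_eq_coneTerm`). Hence the l-th summand on the left collects the terms
of first coordinate l in the double series. The exponent is at least (a + b)², which makes the
regrouping legitimate both formally and analytically. -/

namespace XXZ

/-! ### q-series identities for finite products. -/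

section Algebra

variable {K : Type*} [Field K]

theorem poch_zero (a x : K) : poch a x 0 = 1 := by simp [poch]

theorem poch_succ (a x : K) (N : ℕ) : poch a x (N + 1) = poch a x N * (1 - a * x ^ N) := by
  simp [poch, Finset.prod_range_succ]

theorem poch_succ' (a x : K) (N : ℕ) : poch a x (N + 1) = (1 - a) * poch (a * x) x N := by
  simp only [poch, Finset.prod_range_succ', pow_zero, mul_one]
  rw [mul_comm]
  congr 1
  exact Finset.prod_congr rfl fun i _ => by ring

theorem poch_self_succ (x : K) (N : ℕ) : poch x x (N + 1) = poch x x N * (1 - x ^ (N + 1)) := by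
  rw [poch_succ, pow_succ']

/-- `x` is not a root of unity (and not zero). -/
def Generic (x : K) : Prop := x ≠ 0 ∧ ∀ N : ℕ, x ^ (N + 1) ≠ 1

theorem Generic.one_sub_ne_zero {x : K} (hx : Generic x) (N : ℕ) : 1 - x ^ (N + 1) ≠ 0 :=
  sub_ne_zero.mpr (hx.2 N).symm

theorem Generic.inv {x : K} (hx : Generic x) : Generic x⁻¹ :=
  ⟨inv_ne_zero hx.1, fun N h => hx.2 N (by rwa [inv_pow, inv_eq_one] at h)⟩

theorem Generic.poch_ne_zero {x : K} (hx : Generic x) (N : ℕ) : poch x x N ≠ 0 := by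
  rw [poch, Finset.prod_ne_zero_iff]
  intro i _
  rw [← pow_succ']
  exact hx.one_sub_ne_zero i

/-- The `q`-binomial theorem. -/
theorem sum_qbinomial {x : K} (hx : Generic x) (t : K) (a : ℕ) :
    ∑ z ∈ Finset.HasAntidiagonal.antidiagonal a,
      (-1) ^ z.1 * x ^ z.1.choose 2 * t ^ z.1 / (poch x x z.1 * poch x x z.2) =
      poch t x a / poch x x a := by
  induction a with
  | zero => simp [poch_zero]
  | succ a ih =>
    have h1 := hx.one_sub_ne_zero a
    have hp := hx.poch_ne_zero a
    -- On the antidiagonal 1 - x^(a+1) = (1 - x^z.2) + x^z.2 (1 - x^z.1). Each part cancels one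
    -- factor of the denominator and so descends to the antidiagonal of a; the boundary terms
    -- vanish.
    have hsplit : (1 - x ^ (a + 1)) * ∑ z ∈ Finset.HasAntidiagonal.antidiagonal (a + 1),
        (-1) ^ z.1 * x ^ z.1.choose 2 * t ^ z.1 / (poch x x z.1 * poch x x z.2) =
        ∑ z ∈ Finset.HasAntidiagonal.antidiagonal (a + 1),
          (-1) ^ z.1 * x ^ z.1.choose 2 * t ^ z.1 / (poch x x z.1 * poch x x z.2) * (1 - x ^ z.2) +
        ∑ z ∈ Finset.HasAntidiagonal.antidiagonal (a + 1),
          (-1) ^ z.1 * x ^ z.1.choose 2 * t ^ z.1 / (poch x x z.1 * poch x x z.2) *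
            (x ^ z.2 * (1 - x ^ z.1)) := by
      rw [Finset.mul_sum, ← Finset.sum_add_distrib]
      refine Finset.sum_congr rfl fun z hz => ?_
      rw [← Finset.HasAntidiagonal.mem_antidiagonal.mp hz]
      ring
    rw [Finset.Nat.sum_antidiagonal_succ' (f := fun z : ℕ × ℕ => (-1) ^ z.1 * x ^ z.1.choose 2 *
        t ^ z.1 / (poch x x z.1 * poch x x z.2) * (1 - x ^ z.2)),
      Finset.Nat.sum_antidiagonal_succ (f := fun z : ℕ × ℕ => (-1) ^ z.1 * x ^ z.1.choose 2 *
        t ^ z.1 / (poch x x z.1 * poch x x z.2) * (x ^ z.2 * (1 - x ^ z.1)))] at hsplit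
    have e1 : ∀ z ∈ Finset.HasAntidiagonal.antidiagonal a,
        (-1) ^ z.1 * x ^ z.1.choose 2 * t ^ z.1 / (poch x x z.1 * poch x x (z.2 + 1)) *
          (1 - x ^ (z.2 + 1)) =
        (-1) ^ z.1 * x ^ z.1.choose 2 * t ^ z.1 / (poch x x z.1 * poch x x z.2) := by
      intro z _
      have := hx.one_sub_ne_zero z.2
      have := hx.poch_ne_zero z.2
      have := hx.poch_ne_zero z.1
      rw [poch_self_succ]
      field_simp
    have e2 : ∀ z ∈ Finset.HasAntidiagonal.antidiagonal a,
        (-1) ^ (z.1 + 1) * x ^ (z.1 + 1).choose 2 * t ^ (z.1 + 1) /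
          (poch x x (z.1 + 1) * poch x x z.2) * (x ^ z.2 * (1 - x ^ (z.1 + 1))) =
        -(t * x ^ a) *
          ((-1) ^ z.1 * x ^ z.1.choose 2 * t ^ z.1 / (poch x x z.1 * poch x x z.2)) := by
      intro z hz
      have := hx.one_sub_ne_zero z.1
      have := hx.poch_ne_zero z.2
      have := hx.poch_ne_zero z.1
      rw [poch_self_succ, ← Finset.HasAntidiagonal.mem_antidiagonal.mp hz, Nat.choose_succ_succ' z.1 1,
        Nat.choose_one_right, pow_add x z.1 (z.1.choose 2)]
      field_simp
      ring
    rw [Finset.sum_congr rfl e1, Finset.sum_congr rfl e2, ← Finset.mul_sum, ih] at hsplit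
    rw [poch_succ, poch_self_succ, ← mul_right_inj' h1, hsplit]
    field_simp
    ring

/-- The arguments x^(-b), x^(1-b), … reach 1 once a > b, which kills the product. This vanishing is
what later cuts the cone down to a smaller one. -/
theorem pow_mul_poch_inv_pow {x : K} (hx : Generic x) (a b : ℕ) :
    x ^ (b * a) * poch (x⁻¹ ^ b) x a =
      if a ≤ b then (-1) ^ a * x ^ a.choose 2 * poch x x b / poch x x (b - a) else 0 := by
  have h0 := hx.1
  induction a with
  | zero => simp [poch_zero, hx.poch_ne_zero]
  | succ a ih =>
    have hstep : x ^ (b * (a + 1)) * poch (x⁻¹ ^ b) x (a + 1) =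
        (x ^ (b * a) * poch (x⁻¹ ^ b) x a) * (x ^ b - x ^ a) := by
      rw [poch_succ, mul_add, pow_add, inv_pow]
      field_simp
      ring
    rw [hstep, ih]
    rcases lt_trichotomy a b with h | h | h
    · obtain ⟨c, rfl⟩ := Nat.exists_eq_add_of_lt h
      rw [if_pos (by omega), if_pos (by omega), show a + c + 1 - a = c + 1 by omega,
        show a + c + 1 - (a + 1) = c by omega, poch_self_succ x c,
        Nat.choose_succ_succ' a 1, Nat.choose_one_right, pow_add x a (a.choose 2)]
      have := hx.one_sub_ne_zero c
      have := hx.poch_ne_zero c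
      field_simp
      ring
    · subst h; simp
    · rw [if_neg (by omega), if_neg (by omega), zero_mul]

/-- The coefficients of the bosonic expansions. -/
def coeffW (x : K) (a b : ℕ) : K :=
  (-1) ^ a * x ^ a.choose 2 * (1 - x ^ a + x ^ (a + b)) / (poch x x a * poch x x b)

theorem poch_inv {x : K} (h0 : x ≠ 0) (N : ℕ) :
    poch x x N = (-1) ^ N * x ^ (N + 1).choose 2 * poch x⁻¹ x⁻¹ N := by
  induction N with
  | zero => simp [poch_zero]
  | succ N ih =>
    rw [poch_self_succ, poch_self_succ, ih, Nat.choose_succ_succ' (N + 1) 1, Nat.choose_one_right,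
      pow_add x (N + 1) ((N + 1).choose 2), inv_pow]
    field_simp
    ring

/-- The numerator has the symmetry 1 - x^(-a) + x^(-a-b) = x^(-a-b) (1 - x^b + x^(a+b)); the
remaining powers of x come from `poch_inv`. -/
theorem coeffW_inv {x : K} (hx : Generic x) (a b : ℕ) : coeffW x⁻¹ a b = coeffW x b a := by
  have h0 := hx.1
  have ha := hx.inv.poch_ne_zero a
  have hb := hx.inv.poch_ne_zero b
  rw [coeffW, coeffW, poch_inv h0 a, poch_inv h0 b, Nat.choose_succ_succ' a 1,
    Nat.choose_succ_succ' b 1, Nat.choose_one_right, Nat.choose_one_right, pow_add x a,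
    pow_add x b (b.choose 2), inv_pow, inv_pow, inv_pow, pow_add x b a, pow_add x a b]
  have e : ∀ n : ℕ, ((-1 : K) ^ n) ^ 2 = 1 := fun n => by rw [← pow_mul, pow_mul', neg_one_sq, one_pow]
  generalize poch x⁻¹ x⁻¹ a = s at *
  generalize poch x⁻¹ x⁻¹ b = t at *
  field_simp
  linear_combination (x ^ a * x ^ b - x ^ b + 1) * e a

/-- The numerator 1 + (x^b - 1) x^a is affine in x^a, so the sum splits into two q-binomial sums, at
t = x^(-b) and t = x^(1-b). -/
theorem sum_coeffW {x : K} (hx : Generic x) (a b : ℕ) :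
    ∑ z ∈ Finset.HasAntidiagonal.antidiagonal a, coeffW x z.1 b * (x ^ (b * z.2) / poch x x z.2) =
      if a ≤ b then coeffW x a (b - a) else 0 := by
  have h0 := hx.1
  have hb := hx.poch_ne_zero b
  have ha := hx.poch_ne_zero a
  have hz : ∀ z ∈ Finset.HasAntidiagonal.antidiagonal a, coeffW x z.1 b * (x ^ (b * z.2) / poch x x z.2) =
      x ^ (b * a) / poch x x b * ((-1) ^ z.1 * x ^ z.1.choose 2 * (x⁻¹ ^ b) ^ z.1 /
        (poch x x z.1 * poch x x z.2)) + x ^ (b * a) / poch x x b * (x ^ b - 1) *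
        ((-1) ^ z.1 * x ^ z.1.choose 2 * (x⁻¹ ^ b * x) ^ z.1 /
        (poch x x z.1 * poch x x z.2)) := by
    intro z hz
    have := hx.poch_ne_zero z.2
    have := hx.poch_ne_zero z.1
    rw [coeffW, ← Finset.HasAntidiagonal.mem_antidiagonal.mp hz, mul_pow, ← pow_mul, inv_pow, mul_add b, pow_add,
      pow_add]
    field_simp
    ring
  rw [Finset.sum_congr rfl hz, Finset.sum_add_distrib, ← Finset.mul_sum, ← Finset.mul_sum,
    sum_qbinomial hx, sum_qbinomial hx]
  -- Both sides are x^b times the product of length a + 1 starting at x^(-b), with its first or its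
  -- last factor split off.
  have hshift : (x ^ b - 1) * poch (x⁻¹ ^ b * x) x a = poch (x⁻¹ ^ b) x a * (x ^ b - x ^ a) := by
    have h := (poch_succ' (x⁻¹ ^ b) x a).symm.trans (poch_succ _ _ _)
    have hxb : x ^ b * x⁻¹ ^ b = 1 := by rw [← mul_pow, mul_inv_cancel₀ h0, one_pow]
    linear_combination x ^ b * h + (poch (x⁻¹ ^ b * x) x a - poch (x⁻¹ ^ b) x a * x ^ a) * hxb
  have hmain := pow_mul_poch_inv_pow hx a b
  calc _ = (x ^ (b * a) * poch (x⁻¹ ^ b) x a) * (1 + x ^ b - x ^ a) /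
        (poch x x b * poch x x a) := by
        generalize poch (x⁻¹ ^ b * x) x a = s at *
        generalize poch (x⁻¹ ^ b) x a = t at *
        field_simp
        linear_combination hshift
    _ = _ := by
        rw [hmain]
        split_ifs with h
        · have := hx.poch_ne_zero (b - a)
          rw [coeffW, Nat.add_sub_cancel' h]
          field_simp
          ring
        · simp

/-- Two q-binomial sums, at t = x^l and t = x^(l+1), which cancel for l > 0 because (1 + x^l)(1 -
x^l) = 1 - x^(2l). -/
theorem sum_coeffW_base {x : K} (hx : Generic x) (l : ℕ) :
    ∑ z ∈ Finset.HasAntidiagonal.antidiagonal l, coeffW x z.1 z.2 * x ^ (l * z.1) = if l = 0 then 1 else 0 := by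
  have hl := hx.poch_ne_zero l
  have hz : ∀ z ∈ Finset.HasAntidiagonal.antidiagonal l, coeffW x z.1 z.2 * x ^ (l * z.1) =
      (1 + x ^ l) * ((-1) ^ z.1 * x ^ z.1.choose 2 * (x ^ l) ^ z.1 /
        (poch x x z.1 * poch x x z.2)) -
      (-1) ^ z.1 * x ^ z.1.choose 2 * (x ^ l * x) ^ z.1 / (poch x x z.1 * poch x x z.2) := by
    intro z hz
    rw [coeffW, Finset.HasAntidiagonal.mem_antidiagonal.mp hz, mul_pow, ← pow_mul]
    ring
  rw [Finset.sum_congr rfl hz, Finset.sum_sub_distrib, ← Finset.mul_sum,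
    sum_qbinomial hx, sum_qbinomial hx]
  rcases l with _ | l
  · simp [poch_zero]
  · rw [if_neg (Nat.succ_ne_zero l), poch_succ', poch_succ (x ^ (l + 1) * x)]
    ring

end Algebra

/-- The pairs `(a, b)` with `a F + b G = u`; the bounds are automatic for positive `F`, `G`. -/
def sols (F G u : ℕ) : Finset (ℕ × ℕ) :=
  (Finset.range (u + 1) ×ˢ Finset.range (u + 1)).filter fun x => x.1 * F + x.2 * G = u

theorem mem_sols {F G u : ℕ} (hF : 0 < F) (hG : 0 < G) (x : ℕ × ℕ) :
    x ∈ sols F G u ↔ x.1 * F + x.2 * G = u := by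
  simp only [sols, Finset.mem_filter, Finset.mem_product, Finset.mem_range, and_iff_right_iff_imp]
  rintro rfl
  have := Nat.le_mul_of_pos_right x.1 hF
  have := Nat.le_mul_of_pos_right x.2 hG
  omega

theorem sols_one_one (u : ℕ) : sols 1 1 u = Finset.HasAntidiagonal.antidiagonal u := by
  ext x
  simp [mem_sols]

theorem sum_sols_swap {M : Type*} [AddCommMonoid M] (F G u : ℕ) (f : ℕ × ℕ → M) :
    ∑ x ∈ sols F G u, f x = ∑ x ∈ sols G F u, f x.swap := by
  refine Finset.sum_nbij' Prod.swap Prod.swap ?_ ?_ ?_ ?_ ?_ <;>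
    simp +contextual [sols, add_comm]

/-! ### Summing the components of λ one at a time. -/

section Fermion

variable {K : Type*} [Field K]

/-- The vectors `λ ∈ ℕ^J` with `∑ n_k λ_k = u`. -/
def levelSet (a : ℕ → ℕ) (J u : ℕ) : Finset (Fin J → ℕ) :=
  (Fintype.piFinset fun _ => Finset.range (u + 1)).filter
    fun lam => ∑ k : Fin J, a ((k : ℕ) + 1) * lam k = u

theorem mem_levelSet {a : ℕ → ℕ} (ha : ∀ j, 0 < a (j + 1)) {J u : ℕ} (lam : Fin J → ℕ) :
    lam ∈ levelSet a J u ↔ ∑ k : Fin J, a ((k : ℕ) + 1) * lam k = u := by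
  simp only [levelSet, Finset.mem_filter, Fintype.mem_piFinset, Finset.mem_range,
    and_iff_right_iff_imp]
  rintro rfl k
  have h1 : lam k ≤ a ((k : ℕ) + 1) * lam k := Nat.le_mul_of_pos_left _ (ha _)
  have h2 := Finset.single_le_sum (f := fun k : Fin J => a ((k : ℕ) + 1) * lam k)
    (fun _ _ => Nat.zero_le _) (Finset.mem_univ k)
  exact Nat.lt_succ_of_le (h1.trans h2)

/-- The quadratic form `∑ a_{min(i,j)} b_{max(i,j)} λ_i λ_j`. -/
def minMaxForm (a b : ℕ → ℕ) (J : ℕ) (lam : Fin J → ℕ) : ℕ :=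
  ∑ i : Fin J, ∑ j : Fin J,
    a (min (i : ℕ) j + 1) * b (max (i : ℕ) j + 1) * (lam i * lam j)

/-- The new label is the maximum of every pair containing it, so the old components enter the cross
terms only through their level. -/
theorem minMaxForm_snoc (a b : ℕ → ℕ) (J : ℕ) (lam : Fin J → ℕ) (x : ℕ) :
    minMaxForm a b (J + 1) (Fin.snoc lam x) = minMaxForm a b J lam +
      b (J + 1) * (2 * (∑ k : Fin J, a ((k : ℕ) + 1) * lam k) + a (J + 1) * x) * x := by
  have h1 : ∀ i : Fin J, min (i : ℕ) J = i := fun i => min_eq_left i.2.le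
  have h2 : ∀ i : Fin J, max (i : ℕ) J = J := fun i => max_eq_right i.2.le
  have h3 : ∀ i : Fin J, min J (i : ℕ) = i := fun i => min_eq_right i.2.le
  have h4 : ∀ i : Fin J, max J (i : ℕ) = J := fun i => max_eq_left i.2.le
  simp only [minMaxForm, Fin.sum_univ_castSucc, Fin.snoc_castSucc, Fin.snoc_last, Fin.val_castSucc,
    Fin.val_last, h1, h2, h3, h4, Finset.sum_add_distrib, min_self, max_self]
  have e1 : ∑ i : Fin J, a (i + 1) * b (J + 1) * (lam i * x) =
      b (J + 1) * (∑ i : Fin J, a (i + 1) * lam i) * x := by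
    rw [Finset.mul_sum, Finset.sum_mul]
    exact Finset.sum_congr rfl fun i _ => by ring
  have e2 : ∑ i : Fin J, a (i + 1) * b (J + 1) * (x * lam i) =
      b (J + 1) * (∑ i : Fin J, a (i + 1) * lam i) * x := by
    rw [Finset.mul_sum, Finset.sum_mul]
    exact Finset.sum_congr rfl fun i _ => by ring
  rw [e1, e2]
  ring

/-- The sum over the first `J` components of `λ`, built up one component at a time. -/
def partialSum (q : K) (a b : ℕ → ℕ) (wt : ℕ → ℕ → K) : ℕ → ℕ → K
  | 0, u => if u = 0 then 1 else 0
  | J + 1, u => ∑ y ∈ sols 1 (a (J + 1)) u,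
      partialSum q a b wt J y.1 *
        (q ^ (b (J + 1) * (2 * y.1 + a (J + 1) * y.2) * y.2) * wt (J + 1) y.2)

theorem sum_levelSet {a : ℕ → ℕ} (ha : ∀ j, 0 < a (j + 1)) (q : K) (b : ℕ → ℕ) (wt : ℕ → ℕ → K)
    (J u : ℕ) :
    ∑ lam ∈ levelSet a J u, q ^ minMaxForm a b J lam * ∏ j : Fin J, wt ((j : ℕ) + 1) (lam j) =
      partialSum q a b wt J u := by
  induction J generalizing u with
  | zero =>
    by_cases h : u = 0
    · subst h
      simp [levelSet, minMaxForm, partialSum]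
    · simp [levelSet, partialSum, h, Ne.symm h]
  | succ J ih =>
    simp only [partialSum, ← ih, Finset.sum_mul]
    rw [Finset.sum_sigma']
    symm
    refine Finset.sum_nbij'
      (fun w : (_ : ℕ × ℕ) × (Fin J → ℕ) => (Fin.snoc w.2 w.1.2 : Fin (J + 1) → ℕ))
      (fun lam => ⟨(∑ k : Fin J, a ((k : ℕ) + 1) * Fin.init lam k, lam (Fin.last J)),
        Fin.init lam⟩) ?_ ?_ ?_ ?_ ?_
    · rintro ⟨y, lam⟩ h
      simp only [Finset.mem_sigma, mem_levelSet ha, mem_sols one_pos (ha J)] at h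
      simp only [mem_levelSet ha, Fin.sum_univ_castSucc, Fin.snoc_castSucc, Fin.snoc_last,
        Fin.val_castSucc, Fin.val_last]
      rw [h.2, ← h.1]
      ring
    · intro lam h
      rw [mem_levelSet ha, Fin.sum_univ_castSucc] at h
      simp only [Finset.mem_sigma, mem_levelSet ha, mem_sols one_pos (ha J), and_true]
      rw [← h]
      simp [Fin.init, mul_comm]
    · rintro ⟨⟨y1, y2⟩, lam⟩ h
      simp only [Finset.mem_sigma, mem_levelSet ha, mem_sols one_pos (ha J)] at h
      simp [h.2]
    · intro lam _
      simp
    · rintro ⟨y, lam⟩ h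
      simp only [Finset.mem_sigma, mem_levelSet ha, mem_sols one_pos (ha J)] at h
      simp only [minMaxForm_snoc, h.2, Fin.prod_univ_castSucc, Fin.snoc_castSucc, Fin.snoc_last,
        Fin.val_castSucc, Fin.val_last, pow_add]
      ring

end Fermion

/-! ### Lattice sums over unimodular cones. -/

section Boson

variable {K : Type*} [Field K]

/-- The sum over the lattice points `a F + b G` with first coordinate `u`. -/
def latticeSum (q : K) (F G : ℕ × ℕ) (w : ℕ → ℕ → K) (u : ℕ) : K :=
  ∑ x ∈ sols F.1 G.1 u, w x.1 x.2 * q ^ (u * (x.1 * F.2 + x.2 * G.2))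

theorem latticeSum_coeffW_swap {q Q : K} (hQ : Generic Q) (F G : ℕ × ℕ) (u : ℕ) :
    latticeSum q F G (coeffW Q) u = latticeSum q G F (coeffW Q⁻¹) u := by
  rw [latticeSum, latticeSum, sum_sols_swap]
  refine Finset.sum_congr rfl fun x _ => ?_
  rw [coeffW_inv hQ, Prod.fst_swap, Prod.snd_swap, add_comm (x.2 * F.2)]

theorem latticeSum_base {q : K} (hq : Generic q) (u : ℕ) :
    latticeSum q (1, 1) (1, 0) (coeffW q) u = if u = 0 then 1 else 0 := by
  rw [← sum_coeffW_base hq, latticeSum, sols_one_one]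
  simp

/-- The bases `(F, G)` and the parameters `Q = q^{±1}` that occur in the induction. -/
def Oriented (q Q : K) (F G : ℕ × ℕ) : Prop :=
  (Q = q ∧ F.1 * G.2 + 1 = G.1 * F.2) ∨ (Q = q⁻¹ ∧ F.1 * G.2 = G.1 * F.2 + 1)

theorem Oriented.generic {q Q : K} {F G : ℕ × ℕ} (h : Oriented q Q F G) (hq : Generic q) :
    Generic Q := by
  rcases h with ⟨rfl, _⟩ | ⟨rfl, _⟩
  exacts [hq, hq.inv]

theorem Oriented.swap {q Q : K} {F G : ℕ × ℕ} (h : Oriented q Q F G) :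
    Oriented q Q⁻¹ G F := by
  rcases h with ⟨rfl, h⟩ | ⟨rfl, h⟩
  · exact Or.inr ⟨rfl, h.symm⟩
  · exact Or.inl ⟨inv_inv q, h.symm⟩

/-- For P = a F + b G, moving to P + x F changes the product of coordinates by x (P.1 F.2 + F.1 P.2)
+ x² F.1 F.2, whereas the fermionic exponent has 2 P.1 F.2 in place of the bracket. The discrepancy
is x b times the determinant of F and G, which is ±1 according to Q = q^{±1}. -/
theorem Oriented.pow_eq {q Q : K} (h0 : q ≠ 0) {F G : ℕ × ℕ} (h : Oriented q Q F G) (a b x : ℕ) :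
    q ^ ((a * F.1 + b * G.1) * (a * F.2 + b * G.2)) *
      q ^ (F.2 * (2 * (a * F.1 + b * G.1) + F.1 * x) * x) =
      Q ^ (b * x) * q ^ (((a + x) * F.1 + b * G.1) * ((a + x) * F.2 + b * G.2)) := by
  rcases h with ⟨rfl, h⟩ | ⟨rfl, h⟩
  · rw [← pow_add, ← pow_add]
    congr 1
    zify at h ⊢
    linear_combination -(b * x : ℤ) * h
  · rw [inv_pow, eq_inv_mul_iff_mul_eq₀ (pow_ne_zero _ h0), ← pow_add, ← pow_add]
    congr 1
    zify at h ⊢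
    linear_combination -(b * x : ℤ) * h

/-- By `Oriented.pow_eq` all contributions to one point c.1 F + c.2 G form the sum of `sum_coeffW`.
Only c.1 ≤ c.2 survives, and such a point is c.1 (F + G) + (c.2 - c.1) G. -/
theorem latticeSum_step {q Q : K} (hq : Generic q) {F G : ℕ × ℕ} (h : Oriented q Q F G)
    (hF : 0 < F.1) (hG : 0 < G.1) (u : ℕ) :
    ∑ y ∈ sols 1 F.1 u, latticeSum q F G (coeffW Q) y.1 *
      (q ^ (F.2 * (2 * y.1 + F.1 * y.2) * y.2) * (1 / poch Q Q y.2)) =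
      latticeSum q (F + G) G (coeffW Q) u := by
  have h1 : ∑ y ∈ sols 1 F.1 u, latticeSum q F G (coeffW Q) y.1 *
      (q ^ (F.2 * (2 * y.1 + F.1 * y.2) * y.2) * (1 / poch Q Q y.2)) =
      ∑ c ∈ sols F.1 G.1 u, (∑ z ∈ Finset.HasAntidiagonal.antidiagonal c.1,
        coeffW Q z.1 c.2 * (Q ^ (c.2 * z.2) / poch Q Q z.2)) *
          q ^ (u * (c.1 * F.2 + c.2 * G.2)) := by
    simp only [latticeSum, Finset.sum_mul]
    rw [Finset.sum_sigma', Finset.sum_sigma']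
    -- The new component y.2 is absorbed into the coefficient of F. The level y.1 is determined by
    -- the point, hence can be recovered from it.
    refine Finset.sum_nbij'
      (fun w : (_ : ℕ × ℕ) × (ℕ × ℕ) => ⟨(w.2.1 + w.1.2, w.2.2), (w.2.1, w.1.2)⟩)
      (fun w : (_ : ℕ × ℕ) × (ℕ × ℕ) => ⟨(w.2.1 * F.1 + w.1.2 * G.1, w.2.2), (w.2.1, w.1.2)⟩)
      ?_ ?_ ?_ ?_ ?_
    · rintro ⟨⟨y1, y2⟩, ⟨x1, x2⟩⟩ hw
      simp only [Finset.mem_sigma, mem_sols one_pos hF, mem_sols hF hG,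
        Finset.HasAntidiagonal.mem_antidiagonal, and_true] at hw ⊢
      rw [← hw.1, ← hw.2]; ring
    · rintro ⟨⟨c1, c2⟩, ⟨z1, z2⟩⟩ hw
      simp only [Finset.mem_sigma, mem_sols one_pos hF, mem_sols hF hG,
        Finset.HasAntidiagonal.mem_antidiagonal, and_true] at hw ⊢
      rw [← hw.1, ← hw.2]; ring
    · rintro ⟨⟨y1, y2⟩, ⟨x1, x2⟩⟩ hw
      simp only [Finset.mem_sigma, mem_sols one_pos hF, mem_sols hF hG] at hw
      simp [hw.2]
    · rintro ⟨⟨c1, c2⟩, ⟨z1, z2⟩⟩ hw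
      simp only [Finset.mem_sigma, mem_sols hF hG, Finset.HasAntidiagonal.mem_antidiagonal] at hw
      simp [hw.2]
    · rintro ⟨⟨y1, y2⟩, ⟨x1, x2⟩⟩ hw
      simp only [Finset.mem_sigma, mem_sols one_pos hF, mem_sols hF hG] at hw
      obtain ⟨rfl, rfl⟩ := hw
      have := h.pow_eq hq.1 x1 x2 y2
      dsimp only
      rw [show (x1 * F.1 + x2 * G.1) * 1 + y2 * F.1 = (x1 + y2) * F.1 + x2 * G.1 by ring]
      linear_combination coeffW Q x1 x2 / poch Q Q y2 * this
  rw [h1]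
  simp only [sum_coeffW (h.generic hq), ite_mul, zero_mul]
  rw [← Finset.sum_filter, latticeSum]
  refine Finset.sum_nbij' (fun c => (c.1, c.2 - c.1)) (fun x => (x.1, x.1 + x.2)) ?_ ?_ ?_ ?_ ?_
  · rintro ⟨c1, c2⟩ hc
    simp only [Finset.mem_filter, mem_sols hF hG] at hc
    obtain ⟨d, rfl⟩ := Nat.exists_eq_add_of_le hc.2
    rw [mem_sols (by simp [hF]) hG, ← hc.1]
    simp only [Nat.add_sub_cancel_left, Prod.fst_add]
    ring
  · rintro ⟨x1, x2⟩ hx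
    rw [mem_sols (by simp [hF]) hG] at hx
    simp only [Finset.mem_filter, mem_sols hF hG, ← hx, Prod.fst_add]
    exact ⟨by ring, Nat.le_add_right _ _⟩
  · rintro ⟨c1, c2⟩ hc
    have := (Finset.mem_filter.mp hc).2
    simp only at this ⊢
    rw [Nat.add_sub_cancel' this]
  · rintro ⟨x1, x2⟩ _
    simp
  · rintro ⟨c1, c2⟩ hc
    have hle : c1 ≤ c2 := (Finset.mem_filter.mp hc).2
    obtain ⟨d, rfl⟩ := Nat.exists_eq_add_of_le hle
    simp only [Nat.add_sub_cancel_left, Prod.snd_add]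
    congr 2
    ring

/-- Renaming the generators inverts Q and makes G the first one, after which this is an ordinary
step. -/
theorem latticeSum_turn {q Q : K} (hq : Generic q) {F G : ℕ × ℕ} (h : Oriented q Q F G)
    (hF : 0 < F.1) (hG : 0 < G.1) (u : ℕ) :
    ∑ y ∈ sols 1 G.1 u, latticeSum q F G (coeffW Q) y.1 *
      (q ^ (G.2 * (2 * y.1 + G.1 * y.2) * y.2) * (1 / poch Q⁻¹ Q⁻¹ y.2)) =
      latticeSum q (F + G) F (coeffW Q⁻¹) u := by
  rw [add_comm F G, ← latticeSum_step hq h.swap hG hF]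
  refine Finset.sum_congr rfl fun y _ => ?_
  rw [latticeSum_coeffW_swap (h.generic hq)]

end Boson

/-! ### Convergents, stages and sails of p₀. -/

section ContinuedFraction

/-- `zShift p₀ i = z_{i-2}`, with `z_{-2} = 1`. It satisfies the recurrence of `yPrev`. -/
def zShift (p₀ : ℚ) : ℕ → ℕ
  | 0 => 1
  | i + 1 => zPrev p₀ i

theorem zShift_add_two (p₀ : ℚ) (i : ℕ) :
    zShift p₀ (i + 2) = zShift p₀ i + nu p₀ i * zShift p₀ (i + 1) := by
  cases i <;> simp [zShift, zPrev]

/-- The convergents as lattice vectors `(y_{i-1}, z_{i-2})`. -/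
def conv (p₀ : ℚ) (i : ℕ) : ℕ × ℕ := (yPrev p₀ i, zShift p₀ i)

theorem conv_zero (p₀ : ℚ) : conv p₀ 0 = (0, 1) := rfl

theorem conv_one (p₀ : ℚ) : conv p₀ 1 = (1, 0) := rfl

theorem conv_add_two (p₀ : ℚ) (i : ℕ) :
    conv p₀ (i + 2) = conv p₀ i + nu p₀ i • conv p₀ (i + 1) := by
  simp [conv, zShift_add_two, yPrev]

/-- The lattice points `e_j = (n_j, ·)` on the sails of `p₀`. -/
noncomputable def sail (p₀ : ℚ) (j : ℕ) : ℕ × ℕ :=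
  conv p₀ (r p₀ j) + (j - m p₀ (r p₀ j)) • conv p₀ (r p₀ j + 1)

theorem sail_fst (p₀ : ℚ) (j : ℕ) : (sail p₀ j).1 = n p₀ j := by
  simp [sail, n, conv, y]

theorem p_add_two (p₀ : ℚ) (i : ℕ) : p p₀ (i + 2) = p p₀ i - nu p₀ i * p p₀ (i + 1) := rfl

theorem p_succ_pos {p₀ : ℚ} (h : 1 ≤ p₀) {i : ℕ} (hi : i ≤ alpha p₀) : 0 < p p₀ (i + 1) := by
  rcases i with _ | i
  · simp [p]
  · refine lt_of_le_of_ne (p_nonneg h _) (Ne.symm fun h0 => ?_)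
    exact Nat.notMem_of_lt_sInf (Nat.lt_of_succ_le hi) h0

theorem p_alpha_add_two {p₀ : ℚ} (h : 1 ≤ p₀) : p p₀ (alpha p₀ + 2) = 0 :=
  Nat.sInf_mem (exists_p_eq_zero h)

theorem p_succ_le {p₀ : ℚ} (h : 1 ≤ p₀) {i : ℕ} (hi : i ≤ alpha p₀) : p p₀ (i + 1) ≤ p p₀ i := by
  rcases i with _ | i
  · simpa [p] using h
  · have hp := p_succ_pos h (Nat.le_of_succ_le hi)
    have := Nat.lt_floor_add_one (p p₀ i / p p₀ (i + 1))
    rw [div_lt_iff₀ hp] at this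
    rw [p_add_two, nu]
    linarith

theorem nu_pos {p₀ : ℚ} (h : 1 ≤ p₀) {i : ℕ} (hi : i ≤ alpha p₀) : 0 < nu p₀ i :=
  Nat.floor_pos.mpr ((one_le_div (p_succ_pos h hi)).mpr (p_succ_le h hi))

/-- The Euclidean step changes the remainders and the convergents by mutually inverse substitutions.
At the end the remainder p_{α+2} is 0, which makes the last convergent equal to p₀ (`conv_last`). -/
theorem conv_invariant (p₀ : ℚ) (i : ℕ) :
    ((conv p₀ (i + 1)).1 * p p₀ i + (conv p₀ i).1 * p p₀ (i + 1) : ℚ) = p₀ ∧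
    ((conv p₀ (i + 1)).2 * p p₀ i + (conv p₀ i).2 * p p₀ (i + 1) : ℚ) = 1 := by
  induction i with
  | zero => simp [conv_zero, conv_one, p]
  | succ i ih =>
    rw [conv_add_two, p_add_two]
    simp only [Prod.fst_add, Prod.snd_add, Prod.smul_fst, Prod.smul_snd, smul_eq_mul]
    push_cast
    exact ⟨by linear_combination ih.1, by linear_combination ih.2⟩

theorem conv_last {p₀ : ℚ} (h : 1 ≤ p₀) :
    ((conv p₀ (alpha p₀ + 2)).1 : ℚ) = p₀ * (conv p₀ (alpha p₀ + 2)).2 := by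
  have hp := (p_succ_pos h le_rfl).ne'
  obtain ⟨h1, h2⟩ := conv_invariant p₀ (alpha p₀ + 1)
  rw [p_alpha_add_two h, mul_zero, add_zero] at h1 h2
  refine mul_right_cancel₀ hp ?_
  rw [h1, mul_assoc, h2, mul_one]

theorem conv_fst_pos {p₀ : ℚ} (h : 1 ≤ p₀) (i : ℕ) : 0 < (conv p₀ (i + 1)).1 := y_pos h i

theorem conv_det (p₀ : ℚ) (i : ℕ) :
    ((conv p₀ (i + 1)).1 * (conv p₀ i).2 - (conv p₀ i).1 * (conv p₀ (i + 1)).2 : ℚ) =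
      (-1) ^ i := by
  induction i with
  | zero => simp [conv_zero, conv_one]
  | succ i ih =>
    rw [conv_add_two, pow_succ, ← ih]
    simp only [Prod.fst_add, Prod.snd_add, Prod.smul_fst, Prod.smul_snd, smul_eq_mul]
    push_cast
    ring

theorem m_succ (p₀ : ℚ) (i : ℕ) : m p₀ (i + 1) = m p₀ i + nu p₀ i := by
  simp [m, Finset.sum_range_succ]

theorem m_mono (p₀ : ℚ) : Monotone (m p₀) :=
  monotone_nat_of_le_succ fun i => by rw [m_succ]; exact Nat.le_add_right _ _

theorem r_eq {p₀ : ℚ} {i s : ℕ} (hi : i ≤ alpha p₀) (hs : s < nu p₀ i) :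
    r p₀ (m p₀ i + s) = i := by
  rw [r, Nat.findGreatest_eq_iff]
  refine ⟨by omega, fun _ => Nat.le_add_right _ _, fun k hk _ => ?_⟩
  have := m_mono p₀ (Nat.succ_le_of_lt hk)
  rw [Nat.succ_eq_add_one, m_succ] at this
  omega

theorem r_size (p₀ : ℚ) : r p₀ (size p₀) = alpha p₀ + 1 := by
  rw [r, Nat.findGreatest_eq_iff]
  exact ⟨le_rfl, fun _ => le_rfl, fun k hk _ => by omega⟩

theorem r_m {p₀ : ℚ} (h : 1 ≤ p₀) {i : ℕ} (hi : i ≤ alpha p₀ + 1) : r p₀ (m p₀ i) = i := by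
  rcases hi.lt_or_eq with hi | rfl
  · exact r_eq (s := 0) (by omega) (nu_pos h (by omega))
  · exact r_size p₀

theorem sail_eq {p₀ : ℚ} {i s : ℕ} (hi : i ≤ alpha p₀) (hs : s < nu p₀ i) :
    sail p₀ (m p₀ i + s) = conv p₀ i + s • conv p₀ (i + 1) := by
  rw [sail, r_eq hi hs, Nat.add_sub_cancel_left]

theorem sail_m {p₀ : ℚ} (h : 1 ≤ p₀) {i : ℕ} (hi : i ≤ alpha p₀ + 1) :
    sail p₀ (m p₀ i) = conv p₀ i := by
  rw [sail, r_m h hi, Nat.sub_self, zero_smul, add_zero]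

theorem exists_block {p₀ : ℚ} {j : ℕ} (hj : j < size p₀) :
    ∃ i s, i ≤ alpha p₀ ∧ s < nu p₀ i ∧ j = m p₀ i + s := by
  have h0 : m p₀ (r p₀ j) ≤ j := by
    have := Nat.findGreatest_spec (P := fun i => m p₀ i ≤ j) (Nat.zero_le (alpha p₀ + 1))
      (by simp [m])
    exact this
  have h1 : r p₀ j ≤ alpha p₀ := by
    have h2 : r p₀ j ≤ alpha p₀ + 1 := Nat.findGreatest_le _
    rcases h2.lt_or_eq with h2 | h2
    · omega
    · rw [h2] at h0
      exact absurd h0 (not_le.mpr hj)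
  refine ⟨r p₀ j, j - m p₀ (r p₀ j), h1, ?_, by omega⟩
  have h3 : ¬ m p₀ (r p₀ j + 1) ≤ j :=
    Nat.findGreatest_is_greatest (P := fun i => m p₀ i ≤ j) (n := alpha p₀ + 1)
      (Nat.lt_succ_self _) (by omega)
  rw [m_succ] at h3
  omega

end ContinuedFraction

/-! ### The cone invariant along the continued fraction. -/

section Induction

variable {K : Type*} [Field K]

/-- `q^{(-1)^i}`. -/
def signPow (q : K) (i : ℕ) : K := if Even i then q else q⁻¹

theorem signPow_succ (q : K) (i : ℕ) : signPow q (i + 1) = (signPow q i)⁻¹ := by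
  by_cases h : Even i <;> simp [signPow, h, Nat.even_add_one]

theorem Oriented.add_smul {q Q : K} {F G : ℕ × ℕ} (h : Oriented q Q F G) (s : ℕ) :
    Oriented q Q (F + s • G) G := by
  rcases h with ⟨rfl, h⟩ | ⟨rfl, h⟩
  · refine Or.inl ⟨rfl, ?_⟩
    simp only [Prod.fst_add, Prod.snd_add, Prod.smul_fst, Prod.smul_snd, smul_eq_mul]
    rw [mul_add, ← h]; ring
  · refine Or.inr ⟨rfl, ?_⟩
    simp only [Prod.fst_add, Prod.snd_add, Prod.smul_fst, Prod.smul_snd, smul_eq_mul]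
    rw [add_mul, h]; ring

theorem oriented_conv (q : K) (p₀ : ℚ) (i : ℕ) :
    Oriented q (signPow q i) (conv p₀ i) (conv p₀ (i + 1)) := by
  induction i with
  | zero => exact Or.inl ⟨by simp [signPow], by simp [conv_zero, conv_one]⟩
  | succ i ih =>
    rw [signPow_succ, conv_add_two]
    exact (ih.add_smul _).swap

/-- The weight `1 / (q^{ε_j}; q^{ε_j})_x`. -/
noncomputable def weight (p₀ : ℚ) (q : K) (j x : ℕ) : K :=
  1 / poch (signPow q (r p₀ j)) (signPow q (r p₀ j)) x

/-- Inside stage i the vector of the next component is the current first generator, so each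
component is one `latticeSum_step`. -/
theorem partialSum_block {p₀ : ℚ} (h : 1 ≤ p₀) {q : K} (hq : Generic q) {i : ℕ}
    (hi : i ≤ alpha p₀)
    (h0 : ∀ u, partialSum q (fun j => (sail p₀ j).1) (fun j => (sail p₀ j).2) (weight p₀ q)
      (m p₀ i) u =
      latticeSum q (conv p₀ i + 1 • conv p₀ (i + 1)) (conv p₀ (i + 1)) (coeffW (signPow q i)) u)
    (s : ℕ) (hs : s < nu p₀ i) (u : ℕ) :
    partialSum q (fun j => (sail p₀ j).1) (fun j => (sail p₀ j).2) (weight p₀ q) (m p₀ i + s) u =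
      latticeSum q (conv p₀ i + (s + 1) • conv p₀ (i + 1)) (conv p₀ (i + 1))
        (coeffW (signPow q i)) u := by
  induction s generalizing u with
  | zero => simpa using h0 u
  | succ s ih =>
    have hpos := conv_fst_pos h i
    rw [← add_assoc, partialSum]
    simp only [ih (by omega), weight]
    rw [add_assoc, sail_eq hi hs, r_eq hi hs,
      latticeSum_step hq ((oriented_conv q p₀ i).add_smul _) (by simp [hpos]) hpos,
      succ_nsmul _ (s + 1), ← add_assoc]

/-- Just before the corner m_{i+1} the generators are `conv p₀ (i + 2)` and `conv p₀ (i + 1)`. The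
corner component has vector `conv p₀ (i + 1)`, the second of them, so the step there is a turn. -/
theorem partialSum_corner {p₀ : ℚ} (h : 1 ≤ p₀) {q : K} (hq : Generic q) {i : ℕ}
    (hi : i ≤ alpha p₀ + 1) (u : ℕ) :
    partialSum q (fun j => (sail p₀ j).1) (fun j => (sail p₀ j).2) (weight p₀ q) (m p₀ i) u =
      latticeSum q (conv p₀ i + 1 • conv p₀ (i + 1)) (conv p₀ (i + 1))
        (coeffW (signPow q i)) u := by
  induction i generalizing u with
  | zero =>
    have := latticeSum_base hq u
    simpa [m, partialSum, conv_zero, conv_one, signPow] using this.symm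
  | succ i ih =>
    have hi' : i ≤ alpha p₀ := by omega
    obtain ⟨s, hs⟩ := Nat.exists_eq_succ_of_ne_zero (nu_pos h hi').ne'
    have hpos := conv_fst_pos h i
    have hblock := partialSum_block h hq hi' (ih (by omega)) s (by omega)
    have hm : m p₀ (i + 1) = m p₀ i + s + 1 := by rw [m_succ, hs]; rfl
    rw [hm, partialSum]
    simp only [hblock, weight]
    rw [← hm, sail_m h hi, r_m h hi, signPow_succ,
      latticeSum_turn hq ((oriented_conv q p₀ i).add_smul _) (by simp [hpos]) hpos,
      conv_add_two, hs, one_smul, add_comm (conv p₀ (i + 1))]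

end Induction

/-! ### The inverse of the tridiagonal matrix and the quadratic form. -/

section Matrix

/-- The value of the linear functional `(u, v) ↦ a u + b v`. -/
def functional (a b : ℚ) (e : ℕ × ℕ) : ℚ := a * e.1 + b * e.2

theorem functional_add (a b : ℚ) (e f : ℕ × ℕ) :
    functional a b (e + f) = functional a b e + functional a b f := by
  simp only [functional, Prod.fst_add, Prod.snd_add]
  push_cast
  ring

theorem functional_smul (a b : ℚ) (s : ℕ) (e : ℕ × ℕ) :
    functional a b (s • e) = s * functional a b e := by
  simp only [functional, Prod.smul_fst, Prod.smul_snd, smul_eq_mul]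
  push_cast
  ring

theorem neg_one_pow_mul_self (i : ℕ) : ((-1 : ℚ) ^ i) * (-1) ^ i = 1 := by
  rw [← mul_pow]; simp

/-- Consecutive points of a stage differ by its direction vector `conv p₀ (i + 1)`, and at a corner
the recurrence of the convergents plays the same role. As `c_right` gives the opposite value, ε_k
f(e_k) solves the three-term recurrence for every linear f. -/
theorem c_left {p₀ : ℚ} (h : 1 ≤ p₀) (a b : ℚ) {k : ℕ} (hk : k + 1 ≤ size p₀) :
    c p₀ (k + 1) k * (eps p₀ k * functional a b (sail p₀ k)) =
      functional a b (conv p₀ (r p₀ (k + 1) + 1)) - functional a b (sail p₀ (k + 1)) := by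
  have hc : c p₀ (k + 1) k = (-1) ^ (r p₀ (k + 1) + 1) := by
    rw [c, if_neg (by omega), if_neg (by omega), if_pos rfl]
  obtain ⟨i, s, hi, hs, rfl⟩ := exists_block (Nat.lt_of_succ_le hk)
  rw [hc, eps, r_eq hi hs, sail_eq hi hs]
  by_cases hs' : s + 1 < nu p₀ i
  · rw [add_assoc, r_eq hi hs', sail_eq hi hs']
    simp only [functional_add, functional_smul]
    push_cast
    linear_combination -(functional a b (conv p₀ i) + s * functional a b (conv p₀ (i + 1))) *
      neg_one_pow_mul_self i
  · have hm : m p₀ i + s + 1 = m p₀ (i + 1) := by rw [m_succ]; omega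
    have hν : (nu p₀ i : ℚ) = s + 1 := by
      have : nu p₀ i = s + 1 := by omega
      rw [this]; push_cast; rfl
    rw [hm, r_m h (by omega), sail_m h (by omega), conv_add_two]
    simp only [functional_add, functional_smul, hν]
    linear_combination (functional a b (conv p₀ i) + s * functional a b (conv p₀ (i + 1))) *
      neg_one_pow_mul_self i

theorem c_right {p₀ : ℚ} (h : 1 ≤ p₀) (a b : ℚ) {j : ℕ} (hj : j < size p₀) :
    c p₀ j j * (eps p₀ j * functional a b (sail p₀ j)) +
      c p₀ j (j + 1) * (eps p₀ (j + 1) * functional a b (sail p₀ (j + 1))) =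
      functional a b (sail p₀ j) - functional a b (conv p₀ (r p₀ j + 1)) := by
  have hc : c p₀ j (j + 1) = (-1) ^ (r p₀ (j + 1) + 1) := by
    rw [c, if_neg (by omega), if_pos rfl]
  have hd : c p₀ j j =
      if j + 1 = m p₀ (r p₀ j + 1) then (-1) ^ r p₀ j else 2 * (-1) ^ r p₀ j := by
    rw [c, if_pos rfl, if_neg hj.ne]
  obtain ⟨i, s, hi, hs, rfl⟩ := exists_block hj
  rw [hc, hd, eps, eps, r_eq hi hs, sail_eq hi hs, m_succ]
  by_cases hs' : s + 1 < nu p₀ i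
  · rw [if_neg (by omega), add_assoc, r_eq hi hs', sail_eq hi hs']
    simp only [functional_add, functional_smul]
    push_cast
    linear_combination (functional a b (conv p₀ i) + (s - 1) * functional a b (conv p₀ (i + 1))) *
      neg_one_pow_mul_self i
  · have hm : m p₀ i + s + 1 = m p₀ (i + 1) := by rw [m_succ]; omega
    rw [if_pos (by omega), hm, r_m h (by omega), sail_m h (by omega)]
    simp only [functional_add, functional_smul]
    linear_combination (functional a b (conv p₀ i) + (s - 1) * functional a b (conv p₀ (i + 1))) *
      neg_one_pow_mul_self i

theorem c_size (p₀ : ℚ) (a b : ℚ) :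
    c p₀ (size p₀) (size p₀) * (eps p₀ (size p₀) * functional a b (sail p₀ (size p₀))) =
      functional a b (sail p₀ (size p₀)) := by
  rw [c, if_pos rfl, if_pos rfl, eps, r_size]
  linear_combination functional a b (sail p₀ (size p₀)) * neg_one_pow_mul_self (alpha p₀ + 1)

theorem sum_c_mul (p₀ : ℚ) {j : ℕ} (hj : j < size p₀) (f : ℕ → ℚ) (h0 : f 0 = 0) :
    ∑ k : Fin (size p₀), c p₀ (j + 1) ((k : ℕ) + 1) * f ((k : ℕ) + 1) =
      c p₀ (j + 1) j * f j + c p₀ (j + 1) (j + 1) * f (j + 1) +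
        if j + 1 < size p₀ then c p₀ (j + 1) (j + 2) * f (j + 2) else 0 := by
  rw [Fin.sum_univ_eq_sum_range fun k => c p₀ (j + 1) (k + 1) * f (k + 1)]
  have hterm : ∀ k, c p₀ (j + 1) (k + 1) * f (k + 1) =
      (if k + 1 = j then c p₀ (j + 1) j * f j else 0) +
      (if k = j then c p₀ (j + 1) (j + 1) * f (j + 1) else 0) +
      (if k = j + 1 then c p₀ (j + 1) (j + 2) * f (j + 2) else 0) := by
    intro k
    by_cases h1 : k + 1 = j
    · rw [if_pos h1, if_neg (by omega), if_neg (by omega), h1]; ring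
    by_cases h2 : k = j
    · subst h2; simp
    by_cases h3 : k = j + 1
    · subst h3; simp [h1]
    rw [if_neg h1, if_neg h2, if_neg h3, c, if_neg (by omega), if_neg (by omega),
      if_neg (by omega)]
    ring
  rw [Finset.sum_congr rfl fun k _ => hterm k, Finset.sum_add_distrib, Finset.sum_add_distrib,
    Finset.sum_ite_eq', Finset.sum_ite_eq', if_pos (Finset.mem_range.mpr hj)]
  simp only [Finset.mem_range]
  congr 2
  rcases j with _ | j
  · simp [h0]
  · simp only [Nat.add_right_cancel_iff, Finset.sum_ite_eq', Finset.mem_range]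
    rw [if_pos (by omega)]

/-- The entries of `Θ`, as a function of the labels. -/
noncomputable def theta (p₀ : ℚ) (j k : ℕ) : ℚ :=
  (eps p₀ (min j k) * functional 1 0 (sail p₀ (min j k))) *
    (eps p₀ (max j k) * functional (-p₀⁻¹) 1 (sail p₀ (max j k)))

theorem theta_of_le {p₀ : ℚ} {j k : ℕ} (h : j ≤ k) :
    theta p₀ j k = (eps p₀ j * functional 1 0 (sail p₀ j)) *
      (eps p₀ k * functional (-p₀⁻¹) 1 (sail p₀ k)) := by
  rw [theta, min_eq_left h, max_eq_right h]

theorem theta_of_ge {p₀ : ℚ} {j k : ℕ} (h : k ≤ j) :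
    theta p₀ j k = (eps p₀ k * functional 1 0 (sail p₀ k)) *
      (eps p₀ j * functional (-p₀⁻¹) 1 (sail p₀ j)) := by
  rw [theta, min_eq_right h, max_eq_left h]

/-- The right boundary condition for v: the last convergent lies on the kernel of the functional. -/
theorem functional_conv_last {p₀ : ℚ} (h : 1 ≤ p₀) :
    functional (-p₀⁻¹) 1 (conv p₀ (alpha p₀ + 2)) = 0 := by
  have : p₀ ≠ 0 := by linarith
  rw [functional, conv_last h]
  field_simp
  ring

theorem sail_zero {p₀ : ℚ} (h : 1 ≤ p₀) : sail p₀ 0 = (0, 1) := sail_m h (Nat.zero_le _)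

/-- The Wronskian normalisation that yields the diagonal entries 1 in `sum_c_theta`. -/
theorem sail_det {p₀ : ℚ} (j : ℕ) :
    eps p₀ j * ((conv p₀ (r p₀ j + 1)).1 * (sail p₀ j).2 -
      (sail p₀ j).1 * (conv p₀ (r p₀ j + 1)).2 : ℚ) = 1 := by
  rw [← neg_one_pow_mul_self (r p₀ j), eps]
  congr 1
  rw [← conv_det, sail]
  simp only [Prod.fst_add, Prod.snd_add, Prod.smul_fst, Prod.smul_snd, smul_eq_mul]
  push_cast
  ring

/-- The Green matrix argument: off the diagonal a row meets only one of the two solutions u, v of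
the recurrence, and on the diagonal their Wronskian is left. -/
theorem sum_c_theta {p₀ : ℚ} (h : 1 ≤ p₀) {j l : ℕ} (hj : j < size p₀) (hl : l < size p₀) :
    ∑ k : Fin (size p₀), c p₀ (j + 1) ((k : ℕ) + 1) * theta p₀ ((k : ℕ) + 1) (l + 1) =
      if j = l then 1 else 0 := by
  -- The fictitious label 0 may be added to the row since u vanishes there: e_0 = (0, 1).
  rw [sum_c_mul p₀ hj (fun k => theta p₀ k (l + 1))
    (by rw [theta_of_le (Nat.zero_le _), sail_zero h]; simp [functional])]
  have hleft := fun a b => c_left h a b (Nat.succ_le_of_lt hj)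
  have hright : c p₀ (j + 1) (j + 1) *
      (eps p₀ (j + 1) * functional (-p₀⁻¹) 1 (sail p₀ (j + 1))) +
      (if j + 1 < size p₀ then c p₀ (j + 1) (j + 2) *
        (eps p₀ (j + 2) * functional (-p₀⁻¹) 1 (sail p₀ (j + 2))) else 0) =
      functional (-p₀⁻¹) 1 (sail p₀ (j + 1)) -
        functional (-p₀⁻¹) 1 (conv p₀ (r p₀ (j + 1) + 1)) := by
    split_ifs with hj'
    · exact c_right h _ _ hj'
    · have hN : j + 1 = size p₀ := by omega
      rw [hN, c_size, r_size, functional_conv_last h, add_zero, sub_zero]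
  have e : ∀ x : ℚ, (if j + 1 < size p₀ then c p₀ (j + 1) (j + 2) *
      (x * (eps p₀ (j + 2) * functional (-p₀⁻¹) 1 (sail p₀ (j + 2)))) else 0) =
      x * (if j + 1 < size p₀ then c p₀ (j + 1) (j + 2) *
      (eps p₀ (j + 2) * functional (-p₀⁻¹) 1 (sail p₀ (j + 2))) else 0) := by
    intro x; split_ifs <;> ring
  rcases lt_trichotomy j l with hjl | rfl | hjl
  · rw [if_neg hjl.ne, if_pos (by omega), theta_of_le (by omega), theta_of_le (by omega),
      theta_of_le (by omega)]
    have h2 := c_right h 1 0 (show j + 1 < size p₀ by omega)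
    linear_combination (eps p₀ (l + 1) * functional (-p₀⁻¹) 1 (sail p₀ (l + 1))) *
      (hleft 1 0 + h2)
  · rw [if_pos rfl, theta_of_le (by omega), theta_of_le le_rfl, theta_of_ge (by omega)]
    have hdet := sail_det (p₀ := p₀) (j + 1)
    rw [e]
    have hl1 := hleft 1 0
    simp only [functional] at hl1 hright ⊢
    linear_combination (eps p₀ (j + 1) *
      (-p₀⁻¹ * (sail p₀ (j + 1)).1 + 1 * (sail p₀ (j + 1)).2)) * hl1 +
      (eps p₀ (j + 1) * (1 * (sail p₀ (j + 1)).1 + 0 * (sail p₀ (j + 1)).2)) * hright + hdet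
  · rw [if_neg hjl.ne', theta_of_ge (by omega), theta_of_ge (by omega), theta_of_ge (by omega)]
    rw [e]
    linear_combination (eps p₀ (l + 1) * functional 1 0 (sail p₀ (l + 1))) *
      (hleft (-p₀⁻¹) 1 + hright)

theorem thetaInv_inv {p₀ : ℚ} (h : 1 ≤ p₀) :
    (thetaInv p₀)⁻¹ = Matrix.of fun j k : Fin (size p₀) => theta p₀ ((j : ℕ) + 1) ((k : ℕ) + 1) := by
  refine Matrix.inv_eq_right_inv (Matrix.ext fun j l => ?_)
  rw [Matrix.mul_apply, Matrix.one_apply]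
  simp only [thetaInv, Matrix.of_apply, Fin.ext_iff]
  exact sum_c_theta h j.2 l.2

theorem eps_mul_self (p₀ : ℚ) (j : ℕ) : eps p₀ j * eps p₀ j = 1 := neg_one_pow_mul_self _

/-- The signs square to 1, and the term -n_j n_k / p₀ of v is exactly what the share of l² / p₀
cancels. -/
theorem eps_mul_theta (p₀ : ℚ) (j k : ℕ) :
    eps p₀ j * theta p₀ j k * eps p₀ k + p₀⁻¹ * ((sail p₀ j).1 * (sail p₀ k).1) =
      (sail p₀ (min j k)).1 * (sail p₀ (max j k)).2 := by
  rcases le_total j k with hle | hle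
  · rw [theta_of_le hle, min_eq_left hle, max_eq_right hle]
    simp only [functional]
    linear_combination (sail p₀ j).1 * (-p₀⁻¹ * (sail p₀ k).1 + (sail p₀ k).2) *
      (eps p₀ k * eps p₀ k * eps_mul_self p₀ j + eps_mul_self p₀ k)
  · rw [theta_of_ge hle, min_eq_right hle, max_eq_left hle]
    simp only [functional]
    linear_combination (sail p₀ k).1 * (-p₀⁻¹ * (sail p₀ j).1 + (sail p₀ j).2) *
      (eps p₀ k * eps p₀ k * eps_mul_self p₀ j + eps_mul_self p₀ k)

theorem sq_div_add_halfForm {p₀ : ℚ} (h : 1 ≤ p₀) {l : ℕ} {lam : Fin (size p₀) → ℕ}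
    (hl : ∑ k : Fin (size p₀), n p₀ ((k : ℕ) + 1) * lam k = l) :
    (l : ℚ) ^ 2 / p₀ + halfForm p₀ lam =
      (minMaxForm (fun j => (sail p₀ j).1) (fun j => (sail p₀ j).2) (size p₀) lam : ℕ) := by
  have h1 : halfForm p₀ lam = ∑ i : Fin (size p₀), ∑ j : Fin (size p₀),
      (eps p₀ ((i : ℕ) + 1) * theta p₀ ((i : ℕ) + 1) ((j : ℕ) + 1) * eps p₀ ((j : ℕ) + 1)) *
        (lam i * lam j) := by
    rw [halfForm, B, thetaInv_inv h, Matrix.smul_mulVec, dotProduct_smul, smul_eq_mul, ← mul_assoc,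
      one_div_mul_cancel two_ne_zero, one_mul]
    simp only [dotProduct, Matrix.mulVec, Matrix.of_apply, Finset.mul_sum, twist]
    refine Finset.sum_congr rfl fun i _ => Finset.sum_congr rfl fun j _ => by ring
  have h2 : (l : ℚ) ^ 2 / p₀ = ∑ i : Fin (size p₀), ∑ j : Fin (size p₀),
      p₀⁻¹ * ((sail p₀ ((i : ℕ) + 1)).1 * (sail p₀ ((j : ℕ) + 1)).1) * (lam i * lam j) := by
    rw [← hl, div_eq_inv_mul, sq]
    push_cast
    rw [Finset.sum_mul_sum, Finset.mul_sum]
    refine Finset.sum_congr rfl fun i _ => ?_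
    rw [Finset.mul_sum]
    refine Finset.sum_congr rfl fun j _ => ?_
    rw [sail_fst, sail_fst]
    ring
  rw [h1, h2, ← Finset.sum_add_distrib, minMaxForm]
  push_cast
  refine Finset.sum_congr rfl fun i _ => ?_
  rw [← Finset.sum_add_distrib]
  refine Finset.sum_congr rfl fun j _ => ?_
  have := eps_mul_theta p₀ ((i : ℕ) + 1) ((j : ℕ) + 1)
  rw [min_add_add_right, max_add_add_right] at this
  linear_combination (lam i * lam j : ℚ) * this

end Matrix

/-! ### Matching the summands of both sides with cone terms. -/

section Terms

variable {K : Type*} [Field K]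

/-- `pw` is an exponential function `a ↦ q^a` whose base `q` is not a root of unity. -/
structure IsPower (pw : ℚ → K) : Prop where
  map_zero : pw 0 = 1
  map_add : ∀ a b, pw (a + b) = pw a * pw b
  generic : Generic (pw 1)

theorem IsPower.map_natCast {pw : ℚ → K} (h : IsPower pw) (N : ℕ) : pw N = pw 1 ^ N := by
  induction N with
  | zero => simp [h.map_zero]
  | succ N ih => rw [Nat.cast_succ, h.map_add, ih, pow_succ]

theorem IsPower.map_neg_one {pw : ℚ → K} (h : IsPower pw) : pw (-1) = (pw 1)⁻¹ := by
  exact eq_inv_of_mul_eq_one_left (by rw [← h.map_add, neg_add_cancel, h.map_zero])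

theorem IsPower.map_eps {pw : ℚ → K} (h : IsPower pw) (p₀ : ℚ) (j : ℕ) :
    pw (eps p₀ j) = signPow (pw 1) (r p₀ j) := by
  rcases Nat.even_or_odd (r p₀ j) with hr | hr
  · rw [eps, hr.neg_one_pow, signPow, if_pos hr]
  · rw [eps, hr.neg_one_pow, signPow, if_neg (Nat.not_even_iff_odd.mpr hr), h.map_neg_one]

/-- The two generators of the cone over which the bosonic sum runs. -/
noncomputable def coneBasis (p₀ : ℚ) : (ℕ × ℕ) × (ℕ × ℕ) :=
  (conv p₀ (alpha p₀ + 1) + conv p₀ (alpha p₀ + 2), conv p₀ (alpha p₀ + 2))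

theorem lhsTerm_eq {p₀ : ℚ} (h : 1 ≤ p₀) {pw : ℚ → K} (hpw : IsPower pw) (l : ℕ) :
    lhsTerm p₀ pw l = latticeSum (pw 1) (coneBasis p₀).1 (coneBasis p₀).2
      (coeffW (signPow (pw 1) (alpha p₀ + 1))) l := by
  have hpos : ∀ j, 0 < (sail p₀ (j + 1)).1 := fun j => by
    rw [sail_fst]; exact n_pos h (Nat.succ_pos j)
  have hmain := partialSum_corner h hpw.generic le_rfl l
  rw [one_smul] at hmain
  rw [coneBasis, ← hmain, ← sum_levelSet hpos, lhsTerm, V, Finset.mul_sum]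
  have hset : levelSet (fun j => (sail p₀ j).1) (m p₀ (alpha p₀ + 1)) l = confs p₀ l := by
    simp only [levelSet, sail_fst]
    rfl
  rw [hset]
  refine Finset.sum_congr rfl fun lam hlam => ?_
  have hform := sq_div_add_halfForm h ((mem_confs h l lam).mp hlam)
  have hpow := hpw.map_natCast
    (minMaxForm (fun j => (sail p₀ j).1) (fun j => (sail p₀ j).2) (size p₀) lam)
  rw [← hform, hpw.map_add] at hpow
  change _ = pw 1 ^ minMaxForm (fun j => (sail p₀ j).1) (fun j => (sail p₀ j).2) (size p₀) lam *
    ∏ j : Fin (size p₀), weight p₀ (pw 1) ((j : ℕ) + 1) (lam j)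
  rw [← hpow]
  simp only [weight, hpw.map_eps, one_div, Finset.prod_inv_distrib]
  rw [div_eq_mul_inv (pw (halfForm p₀ lam)), mul_assoc]

/-- The exponent of the lattice point `x.1 F + x.2 G`. -/
noncomputable def coneExp (p₀ : ℚ) (x : ℕ × ℕ) : ℕ :=
  (x.1 * (coneBasis p₀).1.1 + x.2 * (coneBasis p₀).2.1) *
    (x.1 * (coneBasis p₀).1.2 + x.2 * (coneBasis p₀).2.2)

/-- The summand of the bosonic sum at the lattice point `x.1 F + x.2 G` of the cone. -/
noncomputable def coneTerm (p₀ : ℚ) (q : K) (x : ℕ × ℕ) : K :=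
  coeffW (signPow q (alpha p₀ + 1)) x.1 x.2 *
    q ^ coneExp p₀ x

theorem coneBasis_fst_pos {p₀ : ℚ} (h : 1 ≤ p₀) :
    0 < (coneBasis p₀).1.1 ∧ 0 < (coneBasis p₀).2.1 := by
  have h1 := conv_fst_pos h (alpha p₀)
  have h2 := conv_fst_pos h (alpha p₀ + 1)
  exact ⟨Nat.add_pos_left h1 _, h2⟩

theorem coneBasis_snd_pos {p₀ : ℚ} (h : 1 ≤ p₀) :
    0 < (coneBasis p₀).1.2 ∧ 0 < (coneBasis p₀).2.2 := by
  have h2 : 0 < (conv p₀ (alpha p₀ + 2)).2 := by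
    refine Nat.pos_of_ne_zero fun h0 => ?_
    have h1 := conv_last h
    rw [h0, Nat.cast_zero, mul_zero, Nat.cast_eq_zero] at h1
    exact (conv_fst_pos h (alpha p₀ + 1)).ne' h1
  exact ⟨Nat.add_pos_right _ h2, h2⟩

theorem lhsTerm_eq_sum_coneTerm {p₀ : ℚ} (h : 1 ≤ p₀) {pw : ℚ → K} (hpw : IsPower pw) (l : ℕ) :
    lhsTerm p₀ pw l =
      ∑ x ∈ sols (coneBasis p₀).1.1 (coneBasis p₀).2.1 l, coneTerm p₀ (pw 1) x := by
  rw [lhsTerm_eq h hpw, latticeSum]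
  refine Finset.sum_congr rfl fun x hx => ?_
  rw [coneTerm, coneExp, (mem_sols (coneBasis_fst_pos h).1 (coneBasis_fst_pos h).2 x).mp hx]

theorem coneTerm_zero (p₀ : ℚ) (q : K) : coneTerm p₀ q (0, 0) = 1 := by
  simp [coneTerm, coneExp, coeffW, poch_zero]

/-- The factor 1 - x^b encodes the convention at the edge: for b = 0 the Gaussian binomial is zero
by definition. -/
theorem gauss_pred {x : K} (hx : Generic x) {a b k : ℕ} (hk : a + b = k + 1) :
    gauss x (((a + b : ℕ) : ℤ) - 1) a =
      (1 - x ^ b) * poch x x k / (poch x x a * poch x x b) := by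
  have ha := hx.poch_ne_zero a
  have hb := hx.poch_ne_zero b
  rw [gauss]
  rcases b with _ | b
  · rw [if_neg (by omega)]; simp
  · have := hx.poch_ne_zero b
    have := hx.one_sub_ne_zero b
    rw [if_pos (by omega), show (((a + (b + 1) : ℕ) : ℤ) - 1).toNat = k by omega,
      show (((a + (b + 1) : ℕ) : ℤ) - 1 - a).toNat = b by omega, Int.toNat_natCast,
      poch_self_succ]
    field_simp

theorem gauss_pred_pred {x : K} (hx : Generic x) {a b k : ℕ} (hk : a + b = k + 1) :
    gauss x (((a + b : ℕ) : ℤ) - 1) ((a : ℤ) - 1) =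
      (1 - x ^ a) * poch x x k / (poch x x a * poch x x b) := by
  have ha := hx.poch_ne_zero a
  have hb := hx.poch_ne_zero b
  rw [gauss]
  rcases a with _ | a
  · rw [if_neg (by omega)]; simp
  · have := hx.poch_ne_zero a
    have := hx.one_sub_ne_zero a
    rw [if_pos (by omega), show (((a + 1 + b : ℕ) : ℤ) - 1).toNat = k by omega,
      show (((a + 1 + b : ℕ) : ℤ) - 1 - (((a + 1 : ℕ) : ℤ) - 1)).toNat = b by omega,
      show (((a + 1 : ℕ) : ℤ) - 1).toNat = a by omega, poch_self_succ]
    field_simp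

/-- For even α the point is (1 - q^b) + q^(a+2b) (1 - q^a) = (1 - q^(a+b)) (1 - q^b + q^(a+b)),
whose first factor cancels against (q; q)_k. Odd α exchanges a and b. -/
theorem rhsTerm_eq_coneTerm (p₀ : ℚ) {pw : ℚ → K} (hpw : IsPower pw) {a b : ℕ}
    (hab : a + b ≠ 0) : rhsTerm p₀ pw (a + b) a = coneTerm p₀ (pw 1) (a, b) := by
  have hq := hpw.generic
  obtain ⟨k, hk⟩ := Nat.exists_eq_succ_of_ne_zero hab
  have hk' := hq.one_sub_ne_zero k
  have hpk := hq.poch_ne_zero k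
  have hpa := hq.poch_ne_zero a
  have hpb := hq.poch_ne_zero b
  have hexp : (((a + b : ℕ) : ℚ) * y p₀ (alpha p₀ + 1) + a * y p₀ (alpha p₀)) *
      (((a + b : ℕ) : ℚ) * z p₀ (alpha p₀) + a * zPrev p₀ (alpha p₀)) =
      (coneExp p₀ (a, b) : ℕ) := by
    simp only [coneExp, coneBasis, conv, Prod.fst_add, Prod.snd_add, y, z, zShift]
    push_cast
    ring
  have hpoch : poch (pw 1) (pw 1) (a + b) = poch (pw 1) (pw 1) k * (1 - pw 1 ^ (a + b)) := by
    rw [hk, Nat.succ_eq_add_one, poch_self_succ]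
  have hab' : 1 - pw 1 ^ (a + b) ≠ 0 := by rw [hk]; exact hk'
  rw [rhsTerm, hpw.map_add, hexp, hpw.map_natCast, Q, gauss_pred hq hk, gauss_pred_pred hq hk,
    coneTerm, signPow_succ, hpoch, Delta, Nat.add_sub_cancel_left]
  generalize coneExp p₀ (a, b) = N
  rcases Nat.even_or_odd (alpha p₀) with hα | hα
  · rw [signPow, if_pos hα, coeffW_inv hq, coeffW, hα.neg_one_pow, hα.neg_one_pow,
      show ((1 : ℤ) + 1) / 2 * ((a + b : ℕ) : ℤ) + a = ((b + 2 * a : ℕ) : ℤ) by push_cast; ring,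
      show ((1 : ℚ) + 1) / 2 * (b.choose 2) + (1 - 1) / 2 * (a.choose 2) = (b.choose 2 : ℕ) by ring,
      show ((1 : ℚ) - 1) / 2 * ((a + b : ℕ) + a) = 0 by ring,
      show ((1 : ℚ) + 1) / 2 * (2 * (a + b : ℕ) - a) = (a + 2 * b : ℕ) by push_cast; ring,
      zpow_natCast, hpw.map_zero, hpw.map_natCast, hpw.map_natCast, pow_add (-1 : K), pow_mul,
      neg_one_sq, one_pow, mul_one]
    field_simp
    ring
  · rw [signPow, if_neg (Nat.not_even_iff_odd.mpr hα), inv_inv, coeffW, hα.neg_one_pow,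
      hα.neg_one_pow,
      show ((1 : ℤ) + -1) / 2 * ((a + b : ℕ) : ℤ) + a = ((a : ℕ) : ℤ) by simp,
      show ((1 : ℚ) + -1) / 2 * (b.choose 2) + (1 - -1) / 2 * (a.choose 2) = (a.choose 2 : ℕ) by
        ring,
      show ((1 : ℚ) - -1) / 2 * ((a + b : ℕ) + a) = (2 * a + b : ℕ) by push_cast; ring,
      show ((1 : ℚ) + -1) / 2 * (2 * (a + b : ℕ) - a) = 0 by ring,
      zpow_natCast, hpw.map_zero, hpw.map_natCast, hpw.map_natCast]
    field_simp
    ring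

/-- Up to the order of `a` and `b`, the coefficient is that for `q` itself. -/
theorem coneTerm_eq (p₀ : ℚ) {q : K} (hq : Generic q) (x : ℕ × ℕ) :
    ∃ a b : ℕ, a + b = x.1 + x.2 ∧ coneTerm p₀ q x = coeffW q a b *
      q ^ coneExp p₀ x := by
  rw [coneTerm, signPow]
  split_ifs
  · exact ⟨_, _, rfl, rfl⟩
  · exact ⟨x.2, x.1, add_comm _ _, by rw [coeffW_inv hq]⟩

end Terms

/-! ### Regrouping the double series. -/

section Summation

/-- `(k, m) ↦ (m, k - m)`. -/
def pairsEquiv : Pairs ≃ {x : ℕ × ℕ // x ∉ ({(0, 0)} : Finset (ℕ × ℕ))} where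
  toFun x := ⟨(x.1.2, x.1.1 - x.1.2), fun hx => by
    obtain ⟨⟨k, m⟩, hle, hne⟩ := x
    simp only [Finset.mem_singleton, Prod.mk.injEq, ne_eq] at hx hle hne
    omega⟩
  invFun x := ⟨(x.1.1 + x.1.2, x.1.1), Nat.le_add_right _ _, fun hx => x.2 (by
    obtain ⟨⟨a, b⟩, hne⟩ := x
    simp only [Finset.mem_singleton, Prod.mk.injEq] at hx ⊢
    omega)⟩
  left_inv := by
    rintro ⟨⟨k, m⟩, hle, hne⟩
    simp only [Subtype.mk.injEq, Prod.mk.injEq, and_true]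
    exact Nat.add_sub_cancel' hle
  right_inv := by
    rintro ⟨⟨a, b⟩, hne⟩
    simp

theorem rhsTerm_eq_pairsEquiv {K : Type*} [Field K] (p₀ : ℚ) {pw : ℚ → K} (hpw : IsPower pw)
    (x : Pairs) : rhsTerm p₀ pw x.1.1 x.1.2 = coneTerm p₀ (pw 1) (pairsEquiv x).1 := by
  obtain ⟨⟨k, m⟩, hle, hne⟩ := x
  change m ≤ k at hle
  obtain ⟨b, rfl⟩ := Nat.exists_eq_add_of_le hle
  have : m + b ≠ 0 := fun h => hne (by simp only [Prod.mk.injEq]; omega)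
  rw [rhsTerm_eq_coneTerm p₀ hpw this]
  simp [pairsEquiv]

variable {M : Type*} [AddCommGroup M] [TopologicalSpace M] [IsTopologicalAddGroup M]

theorem hasSum_pairs {f : ℕ × ℕ → M} {s : M} (hf : HasSum f s) :
    HasSum (fun x : Pairs => f (pairsEquiv x).1) (s - f (0, 0)) := by
  have h := (Finset.hasSum_compl_iff {((0 : ℕ), (0 : ℕ))} (f := f) (a := s - f (0, 0))).mpr
    (by simpa using hf)
  exact (pairsEquiv.hasSum_iff (f := fun x => f x.1)).mpr h

/-- The finite sets `sols F G l` are the fibres of (a, b) ↦ a F + b G. -/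
theorem hasSum_sols {f : ℕ × ℕ → M} {s : M} (hf : HasSum f s) {F G : ℕ} (hF : 0 < F)
    (hG : 0 < G) : HasSum (fun l => ∑ x ∈ sols F G l, f x) s := by
  have h := (Equiv.sigmaFiberEquiv fun x : ℕ × ℕ => x.1 * F + x.2 * G).hasSum_iff.mpr hf
  refine h.sigma fun l => ?_
  exact ((Equiv.subtypeEquivRight fun x => mem_sols hF hG x).symm.hasSum_iff
    (f := fun x : {x // x ∈ sols F G l} => f x.1)).mpr ((sols F G l).hasSum f)

end Summation

/-! ### Growth of the exponents on the cone. -/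

section Exponents

theorem add_le_cone_fst {p₀ : ℚ} (h : 1 ≤ p₀) (x : ℕ × ℕ) :
    x.1 + x.2 ≤ x.1 * (coneBasis p₀).1.1 + x.2 * (coneBasis p₀).2.1 :=
  Nat.add_le_add (Nat.le_mul_of_pos_right _ (coneBasis_fst_pos h).1)
    (Nat.le_mul_of_pos_right _ (coneBasis_fst_pos h).2)

theorem add_le_cone_snd {p₀ : ℚ} (h : 1 ≤ p₀) (x : ℕ × ℕ) :
    x.1 + x.2 ≤ x.1 * (coneBasis p₀).1.2 + x.2 * (coneBasis p₀).2.2 :=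
  Nat.add_le_add (Nat.le_mul_of_pos_right _ (coneBasis_snd_pos h).1)
    (Nat.le_mul_of_pos_right _ (coneBasis_snd_pos h).2)

theorem sq_le_coneExp {p₀ : ℚ} (h : 1 ≤ p₀) (x : ℕ × ℕ) : (x.1 + x.2) ^ 2 ≤ coneExp p₀ x := by
  rw [sq]
  exact Nat.mul_le_mul (add_le_cone_fst h x) (add_le_cone_snd h x)

theorem le_coneExp {p₀ : ℚ} (h : 1 ≤ p₀) (x : ℕ × ℕ) :
    x.1 * (coneBasis p₀).1.1 + x.2 * (coneBasis p₀).2.1 ≤ coneExp p₀ x := by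
  rcases Nat.eq_zero_or_pos (x.1 + x.2) with h0 | h0
  · obtain ⟨h1, h2⟩ : x.1 = 0 ∧ x.2 = 0 := by omega
    simp [h1, h2]
  · exact Nat.le_mul_of_pos_right _ (h0.trans_le (add_le_cone_snd h x))

end Exponents

/-! ### The identity of Hahn series. -/

section Formal

theorem isPower_formalPow : IsPower formalPow where
  map_zero := rfl
  map_add a b := by simp [formalPow]
  generic := by
    refine ⟨HahnSeries.single_ne_zero one_ne_zero, fun N hN => ?_⟩
    have h := congrArg (fun f : HahnSeries ℚ ℚ => f.coeff 0) hN
    simp only [formalPow, HahnSeries.single_pow, one_pow, HahnSeries.coeff_one] at h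
    rw [HahnSeries.coeff_single_of_ne (by simp; positivity)] at h
    simp at h

open PowerSeries in
-- The denominators have constant coefficient 1, so they are invertible as power series.
theorem exists_powerSeries_coeffW (a b : ℕ) :
    ∃ P : PowerSeries ℚ, coeffW (formalPow 1) a b = HahnSeries.ofPowerSeries ℚ ℚ P := by
  have hX : formalPow 1 = HahnSeries.ofPowerSeries ℚ ℚ (X : PowerSeries ℚ) := by
    rw [HahnSeries.ofPowerSeries_X]; rfl
  have hpoch : ∀ N : ℕ, ∃ P : PowerSeries ℚ,
      (poch (formalPow 1) (formalPow 1) N)⁻¹ = HahnSeries.ofPowerSeries ℚ ℚ P := by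
    intro N
    refine ⟨(∏ i ∈ Finset.range N, (1 - X * X ^ i))⁻¹, ?_⟩
    refine inv_eq_of_mul_eq_one_right ?_
    have hmap : poch (formalPow 1) (formalPow 1) N = HahnSeries.ofPowerSeries ℚ ℚ
        (∏ i ∈ Finset.range N, (1 - X * X ^ i)) := by
      rw [hX, poch, map_prod]
      exact Finset.prod_congr rfl fun i _ => by rw [map_sub, map_one, map_mul, map_pow]
    rw [hmap, ← map_mul, PowerSeries.mul_inv_cancel, map_one]
    simp [map_prod]
  obtain ⟨P, hP⟩ := hpoch a
  obtain ⟨R, hR⟩ := hpoch b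
  refine ⟨(-1) ^ a * X ^ a.choose 2 * (1 - X ^ a + X ^ (a + b)) * (P * R), ?_⟩
  rw [coeffW, div_eq_mul_inv, mul_inv, hP, hR, hX]
  simp only [map_mul, map_add, map_sub, map_one, map_pow, map_neg]

theorem exists_nat_of_coeff_coneTerm_ne_zero (p₀ : ℚ) (x : ℕ × ℕ) {g : ℚ}
    (hg : (coneTerm p₀ (formalPow 1) x).coeff g ≠ 0) : ∃ N : ℕ, coneExp p₀ x ≤ N ∧ g = N := by
  obtain ⟨a, b, -, hx⟩ := coneTerm_eq p₀ isPower_formalPow.generic x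
  obtain ⟨P, hP⟩ := exists_powerSeries_coeffW a b
  have hX : formalPow 1 ^ coneExp p₀ x =
      HahnSeries.ofPowerSeries ℚ ℚ ((PowerSeries.X : PowerSeries ℚ) ^ coneExp p₀ x) := by
    rw [map_pow, HahnSeries.ofPowerSeries_X]; rfl
  rw [hx, hP, hX, ← map_mul] at hg
  by_cases hN : ∃ N : ℕ, g = N
  · obtain ⟨N, rfl⟩ := hN
    refine ⟨N, not_lt.mp fun hlt => hg ?_, rfl⟩
    rw [HahnSeries.ofPowerSeries_apply_coeff, PowerSeries.coeff_mul_X_pow', if_neg (by omega)]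
  · refine absurd ?_ hg
    rw [HahnSeries.ofPowerSeries_apply, HahnSeries.embDomain_of_notMem_range]
    rintro ⟨N, hN'⟩
    exact hN ⟨N, hN'.symm⟩

/-- A family of power series whose orders tend to infinity, as measured by `d`. -/
noncomputable def natFamily {ι : Type*} (t : ι → HahnSeries ℚ ℚ) (d : ι → ℕ)
    (hd : ∀ N, {x | d x ≤ N}.Finite)
    (ht : ∀ x g, (t x).coeff g ≠ 0 → ∃ N : ℕ, d x ≤ N ∧ g = N) :
    HahnSeries.SummableFamily ℚ ℚ ι where
  toFun := t
  isPWO_iUnion_support' := by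
    have hN : (Set.univ : Set ℕ).IsPWO := Set.IsPWO.of_linearOrder _
    refine (hN.image_of_monotone (Nat.mono_cast (α := ℚ))).mono ?_
    intro g hg
    obtain ⟨x, hx⟩ := Set.mem_iUnion.mp hg
    obtain ⟨N, -, rfl⟩ := ht x g hx
    exact ⟨N, trivial, rfl⟩
  finite_co_support' g := by
    by_cases hg : ∃ N : ℕ, g = N
    · obtain ⟨N, rfl⟩ := hg
      refine (hd N).subset fun x hx => ?_
      obtain ⟨M, hM, hNM⟩ := ht x N hx
      rw [Nat.cast_inj.mp hNM]
      exact hM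
    · refine Set.finite_empty.subset fun x hx => ?_
      obtain ⟨M, -, hM⟩ := ht x g hx
      exact hg ⟨M, hM⟩

/-- Turns the finite coefficient sums into `HasSum` statements, so that the regrouping lemmas serve
the formal case too. -/
theorem hasSum_coeff {ι : Type*} (S : HahnSeries.SummableFamily ℚ ℚ ι) (g : ℚ) :
    HasSum (fun i => (S i).coeff g) (S.hsum.coeff g) := by
  rw [HahnSeries.SummableFamily.coeff_hsum, finsum_eq_sum _ (S.finite_co_support g)]
  refine hasSum_sum_of_ne_finset_zero fun i hi => ?_
  by_contra hne
  exact hi ((S.finite_co_support g).mem_toFinset.mpr hne)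

theorem finite_add_le (N : ℕ) : {x : ℕ × ℕ | x.1 + x.2 ≤ N}.Finite := by
  refine (Finset.finite_toSet (Finset.range (N + 1) ×ˢ Finset.range (N + 1))).subset fun x hx => ?_
  simp only [Set.mem_ofPred_eq, Finset.coe_product, Set.mem_prod, Finset.mem_coe,
    Finset.mem_range] at hx ⊢
  omega

theorem formal_identity {p₀ : ℚ} (h : 1 ≤ p₀) :
    ∃ (S : HahnSeries.SummableFamily ℚ ℚ ℕ) (T : HahnSeries.SummableFamily ℚ ℚ Pairs),
      (∀ l, S l = lhsTerm p₀ formalPow l) ∧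
      (∀ x, T x = rhsTerm p₀ formalPow x.1.1 x.1.2) ∧
      S.hsum = 1 + T.hsum := by
  have hcone : ∀ (x : ℕ × ℕ) (g : ℚ), (coneTerm p₀ (formalPow 1) x).coeff g ≠ 0 →
      ∃ N : ℕ, x.1 + x.2 ≤ N ∧ g = N := fun x g hg => by
    obtain ⟨N, hN, rfl⟩ := exists_nat_of_coeff_coneTerm_ne_zero p₀ x hg
    exact ⟨N, ((add_le_cone_fst h x).trans (le_coneExp h x)).trans hN, rfl⟩
  have hlhs : ∀ (l : ℕ) (g : ℚ), (lhsTerm p₀ formalPow l).coeff g ≠ 0 →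
      ∃ N : ℕ, l ≤ N ∧ g = N := fun l g hg => by
    rw [lhsTerm_eq_sum_coneTerm h isPower_formalPow, HahnSeries.coeff_sum] at hg
    obtain ⟨x, hx, hne⟩ := Finset.exists_ne_zero_of_sum_ne_zero hg
    obtain ⟨N, hN, rfl⟩ := exists_nat_of_coeff_coneTerm_ne_zero p₀ x hne
    have hl := (mem_sols (coneBasis_fst_pos h).1 (coneBasis_fst_pos h).2 x).mp hx
    exact ⟨N, hl ▸ (le_coneExp h x).trans hN, rfl⟩
  have hinj : Function.Injective fun x : Pairs => (pairsEquiv x).1 :=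
    Subtype.val_injective.comp pairsEquiv.injective
  let S := natFamily (lhsTerm p₀ formalPow) id Set.finite_le_nat hlhs
  let T := natFamily (fun x : Pairs => rhsTerm p₀ formalPow x.1.1 x.1.2)
    (fun x => (pairsEquiv x).1.1 + (pairsEquiv x).1.2)
    (fun N => (finite_add_le N).preimage hinj.injOn) (fun x g hg => by
      rw [rhsTerm_eq_pairsEquiv p₀ isPower_formalPow] at hg
      exact hcone _ g hg)
  let C := natFamily (coneTerm p₀ (formalPow 1)) (fun x => x.1 + x.2) finite_add_le hcone
  refine ⟨S, T, fun _ => rfl, fun _ => rfl, ?_⟩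
  ext g
  have hC := hasSum_coeff C g
  have hS := hasSum_sols hC (coneBasis_fst_pos h).1 (coneBasis_fst_pos h).2
  have hT := hasSum_pairs hC
  have h0 : C (0, 0) = 1 := coneTerm_zero p₀ _
  have hS' : S.hsum.coeff g = C.hsum.coeff g := by
    refine (hasSum_coeff S g).unique (hS.congr_fun fun l => ?_)
    rw [← HahnSeries.coeff_sum]
    exact congrArg (fun f => f.coeff g) (lhsTerm_eq_sum_coneTerm h isPower_formalPow l)
  have hT' : T.hsum.coeff g = C.hsum.coeff g - (1 : HahnSeries ℚ ℚ).coeff g := by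
    rw [← h0]
    refine (hasSum_coeff T g).unique (hT.congr_fun fun x => ?_)
    exact congrArg (fun f => f.coeff g) (rhsTerm_eq_pairsEquiv p₀ isPower_formalPow x)
  rw [HahnSeries.coeff_add, hS', hT']
  ring

end Formal

/-! ### Absolute convergence and the identity for |q| < 1. -/

section Analytic

theorem norm_complexPow_one_lt (τ : UpperHalfPlane) : ‖complexPow τ 1‖ < 1 := by
  have h := UpperHalfPlane.norm_exp_two_pi_I_lt_one τ
  rw [complexPow]
  convert h using 4
  push_cast
  ring

theorem isPower_complexPow (τ : UpperHalfPlane) : IsPower (complexPow τ) where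
  map_zero := by simp [complexPow]
  map_add a b := by
    rw [complexPow, complexPow, complexPow, ← Complex.exp_add]
    push_cast
    ring_nf
  generic := by
    refine ⟨Complex.exp_ne_zero _, fun N hN => ?_⟩
    have h1 := pow_lt_one₀ (norm_nonneg _) (norm_complexPow_one_lt τ) (Nat.succ_ne_zero N)
    rw [← norm_pow, hN, norm_one] at h1
    exact lt_irrefl _ h1

theorem le_norm_poch {q : ℂ} (hq : ‖q‖ < 1) (N : ℕ) : (1 - ‖q‖) ^ N ≤ ‖poch q q N‖ := by
  rw [poch, norm_prod, ← Finset.card_range N, ← Finset.prod_const, Finset.card_range]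
  refine Finset.prod_le_prod (fun _ _ => by linarith) fun i _ => ?_
  have h1 : ‖q * q ^ i‖ ≤ ‖q‖ := by
    rw [norm_mul, norm_pow]
    exact mul_le_of_le_one_right (norm_nonneg _) (pow_le_one₀ (norm_nonneg _) hq.le)
  have h2 := norm_sub_norm_le 1 (q * q ^ i)
  rw [norm_one] at h2
  linarith

theorem norm_coeffW_le {q : ℂ} (hq : ‖q‖ < 1) (a b : ℕ) :
    ‖coeffW q a b‖ ≤ 3 * ((1 - ‖q‖)⁻¹) ^ (a + b) := by
  have h1 : ∀ k : ℕ, ‖q ^ k‖ ≤ 1 := fun k => by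
    rw [norm_pow]; exact pow_le_one₀ (norm_nonneg _) hq.le
  have h2 : ‖1 - q ^ a + q ^ (a + b)‖ ≤ 3 := by
    refine (norm_add_le _ _).trans ?_
    have := norm_sub_le 1 (q ^ a)
    rw [norm_one] at this
    linarith [h1 a, h1 (a + b)]
  have hpos : 0 < 1 - ‖q‖ := by linarith
  rw [coeffW, norm_div, norm_mul, norm_mul, norm_pow, norm_neg, norm_one, one_pow, one_mul,
    norm_mul, inv_pow, ← div_eq_mul_inv, pow_add (1 - ‖q‖)]
  refine div_le_div₀ (by norm_num) ?_ (by positivity)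
    (mul_le_mul (le_norm_poch hq a) (le_norm_poch hq b) (by positivity) (norm_nonneg _))
  calc ‖q ^ a.choose 2‖ * ‖1 - q ^ a + q ^ (a + b)‖ ≤ 1 * 3 :=
        mul_le_mul (h1 _) h2 (norm_nonneg _) zero_le_one
    _ = 3 := one_mul 3

/-- The expression is (C ρ^k)^k, at most 1 as soon as C ρ^k ≤ 1; for the earlier k it is at most
C^N. -/
theorem exists_pow_mul_pow_sq_le {C ρ : ℝ} (hC : 1 ≤ C) (h0 : 0 ≤ ρ) (h1 : ρ < 1) :
    ∃ D, 0 ≤ D ∧ ∀ k : ℕ, C ^ k * ρ ^ k ^ 2 ≤ D := by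
  have hlim : Filter.Tendsto (fun k : ℕ => C * ρ ^ k) Filter.atTop (nhds 0) := by
    simpa using (tendsto_pow_atTop_nhds_zero_of_lt_one h0 h1).const_mul C
  obtain ⟨N, hN⟩ := Filter.eventually_atTop.mp (hlim.eventually_le_const zero_lt_one)
  refine ⟨C ^ N, by positivity, fun k => ?_⟩
  rcases le_total N k with hk | hk
  · calc C ^ k * ρ ^ k ^ 2 = (C * ρ ^ k) ^ k := by rw [mul_pow, ← pow_mul, sq]
      _ ≤ 1 := pow_le_one₀ (by positivity) (hN k hk)
      _ ≤ C ^ N := one_le_pow₀ hC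
  · calc C ^ k * ρ ^ k ^ 2 ≤ C ^ k * 1 :=
          mul_le_mul_of_nonneg_left (pow_le_one₀ h0 h1.le) (by positivity)
      _ ≤ C ^ N := by rw [mul_one]; exact pow_le_pow_right₀ hC hk

theorem summable_coneTerm {p₀ : ℚ} (h : 1 ≤ p₀) {q : ℂ} (hgen : Generic q) (hq : ‖q‖ < 1) :
    Summable fun x : ℕ × ℕ => coneTerm p₀ q x := by
  have hpos : 0 < 1 - ‖q‖ := by linarith
  -- The extra factor 2 leaves (1/2)^(x.1 + x.2) over, which is summable over pairs.
  have hC : 1 ≤ 2 * (1 - ‖q‖)⁻¹ := by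
    have := (one_le_inv₀ hpos).mpr (by linarith [norm_nonneg q])
    linarith
  obtain ⟨D, hD, hle⟩ := exists_pow_mul_pow_sq_le hC (norm_nonneg q) hq
  have hgeom : Summable fun k : ℕ => (1 / 2 : ℝ) ^ k := summable_geometric_two
  have hsum : Summable fun x : ℕ × ℕ => (1 / 2 : ℝ) ^ x.1 * (1 / 2) ^ x.2 :=
    hgeom.mul_of_nonneg hgeom (fun _ => by positivity) (fun _ => by positivity)
  refine Summable.of_norm_bounded (hsum.mul_left (3 * D)) fun x => ?_
  obtain ⟨a, b, hab, hx⟩ := coneTerm_eq p₀ hgen x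
  rw [hx, norm_mul, norm_pow, ← pow_add]
  calc ‖coeffW q a b‖ * ‖q‖ ^ coneExp p₀ x
      ≤ 3 * ((1 - ‖q‖)⁻¹) ^ (x.1 + x.2) * ‖q‖ ^ (x.1 + x.2) ^ 2 :=
        mul_le_mul (hab ▸ norm_coeffW_le hq a b)
          (pow_le_pow_of_le_one (norm_nonneg _) hq.le (sq_le_coneExp h x)) (by positivity)
          (by positivity)
    _ = 3 * ((2 * (1 - ‖q‖)⁻¹) ^ (x.1 + x.2) * ‖q‖ ^ (x.1 + x.2) ^ 2) *
        (1 / 2) ^ (x.1 + x.2) := by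
        have e : (2 : ℝ) ^ (x.1 + x.2) * (1 / 2) ^ (x.1 + x.2) = 1 := by
          rw [← mul_pow]; norm_num
        rw [mul_pow 2]
        linear_combination -(3 * ((1 - ‖q‖)⁻¹) ^ (x.1 + x.2) * ‖q‖ ^ (x.1 + x.2) ^ 2) * e
    _ ≤ 3 * D * (1 / 2) ^ (x.1 + x.2) := by
        have := hle (x.1 + x.2)
        gcongr

theorem analytic_identity {p₀ : ℚ} (h : 1 ≤ p₀) (τ : UpperHalfPlane) :
    Summable (fun l : ℕ => lhsTerm p₀ (complexPow τ) l) ∧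
      Summable (fun x : Pairs => rhsTerm p₀ (complexPow τ) x.1.1 x.1.2) ∧
      ∑' l : ℕ, lhsTerm p₀ (complexPow τ) l =
        1 + ∑' x : Pairs, rhsTerm p₀ (complexPow τ) x.1.1 x.1.2 := by
  have hpow := isPower_complexPow τ
  have hC := (summable_coneTerm h hpow.generic (norm_complexPow_one_lt τ)).hasSum
  have hS := hasSum_sols hC (coneBasis_fst_pos h).1 (coneBasis_fst_pos h).2
  have hT := hasSum_pairs hC
  simp only [← lhsTerm_eq_sum_coneTerm h hpow] at hS
  simp only [← rhsTerm_eq_pairsEquiv p₀ hpow, coneTerm_zero] at hT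
  refine ⟨hS.summable, hT.summable, ?_⟩
  rw [hS.tsum_eq, hT.tsum_eq]
  ring

end Analytic

end XXZ

theorem theorem2p3 (p₀ : ℚ) (hp₀ : 1 ≤ p₀) :
    -- as an identity of formal series in fractional powers of `q`
    (∃ (S : HahnSeries.SummableFamily ℚ ℚ ℕ) (T : HahnSeries.SummableFamily ℚ ℚ XXZ.Pairs),
      (∀ l, S l = XXZ.lhsTerm p₀ XXZ.formalPow l) ∧
      (∀ x, T x = XXZ.rhsTerm p₀ XXZ.formalPow x.1.1 x.1.2) ∧
      S.hsum = 1 + T.hsum) ∧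
    -- as an identity of absolutely convergent series for `0 < |q| < 1`
    (∀ τ : UpperHalfPlane,
      Summable (fun l : ℕ => XXZ.lhsTerm p₀ (XXZ.complexPow τ) l) ∧
      Summable (fun x : XXZ.Pairs => XXZ.rhsTerm p₀ (XXZ.complexPow τ) x.1.1 x.1.2) ∧
      ∑' l : ℕ, XXZ.lhsTerm p₀ (XXZ.complexPow τ) l =
        1 + ∑' x : XXZ.Pairs, XXZ.rhsTerm p₀ (XXZ.complexPow τ) x.1.1 x.1.2) :=
  ⟨XXZ.formal_identity hp₀, XXZ.analytic_identity hp₀⟩
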